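/- Let $m,n\ge 7$ be integers. Then there is a set $\mathcal S$ of nonzero (possibly unnormalized), mutually orthogonal pure product states in $\mathbb C^m\otimes\mathbb C^n$ that has genuine hidden nonlocality of type II, i.e. (1) $\mathcal S$ is locally distinguishable: some LOCC protocol (finitely many rounds of measurements by single parties, with classical communication) identifies every state of $\mathcal S$ with certainty; (2) $\mathcal S$ is locally irredundant: there are no unitary identifications $\mathbb C^m\cong\mathbb C^p\otimes\mathbb C^q$ and $\mathbb C^n\cong\mathbb C^r\otimes\mathbb C^s$ with $qs>1$ for which the reduced states obtained by tracing out $\mathbb C^q\otimes\mathbb C^s$ are still mutually orthogonal; (3) there is a measurement $\{M_\mu\}$ by one of the parties such that for every outcome $\mu$ the vectors $M_\mu\psi$, $\psi\in\mathcal S$, are mutually orthogonal, the set $\mathcal S'_\mu=\{M_\mu\psi:\psi\in\mathcal S\}\setminus\{0\}$ is locally indistinguishable for every $\mu$, and $|\mathcal S'_\mu|<|\mathcal S|$ for some $\mu$. Moreover, put $f_k=\lfloor (k-1)/2\rfloor$ and $c_k=k-f_k$. The set $\mathcal S$ can be chosen with exactly $2(m+n)-8$ elements and as a disjoint union $\mathcal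 S=\mathcal S_1\cup\mathcal S_2$ such that a two-outcome measurement $\{M_0,M_1\}$ has the properties in (3) and, in addition, $\{M_0\psi:\psi\in\mathcal S_1\}\setminus\{0\}$ is a locally indistinguishable set of $2(c_m+c_n)-4$ states in the subspace $\mathbb C^{c_m}\otimes\mathbb C^{c_n}$ spanned by the $|i\rangle|j\rangle$ with $i<c_m$, $j<c_n$, and $\{M_1\psi:\psi\in\mathcal S_2\}\setminus\{0\}$ is a locally indistinguishable set of $2(f_m+f_n)-4$ states in the subspace $\mathbb C^{f_m}\otimes\mathbb C^{f_n}$ spanned by the $|i\rangle|j\rangle$ with $i\ge c_m$, $j\ge c_n$. -/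

import Mathlib

open scoped Matrix Kronecker

/-- Pure, possibly unnormalized, state vectors of `ℂᵐ ⊗ ℂⁿ`, given by their coordinates in the
computational basis `|i⟩|j⟩`. -/
abbrev BiState (m n : ℕ) : Type := Fin m × Fin n → ℂ

/-- The state has no entanglement: it is of the form `|a⟩|b⟩`. -/
def IsProductState {m n : ℕ} (ψ : BiState m n) : Prop :=
  ∃ (a : Fin m → ℂ) (b : Fin n → ℂ), ∀ i j, ψ (i, j) = a i * b j

/-- A set of nonzero, mutually orthogonal state vectors. -/
def IsOrthogonalStateSet {m n : ℕ} (S : Set (BiState m n)) : Prop :=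
  (∀ ψ ∈ S, ψ ≠ 0) ∧ S.Pairwise (fun φ ψ => star φ ⬝ᵥ ψ = 0)

/-- A quantum measurement on `ℂᵐ` with finitely many outcomes, given by one operator for each
outcome (the output spaces may differ from `ℂᵐ`, which covers the use of ancillas). -/
def IsMeasurement {m r : ℕ} {d : Fin r → ℕ} (K : (k : Fin r) → Matrix (Fin (d k)) (Fin m) ℂ) :
    Prop :=
  ∑ k, (K k)ᴴ * K k = 1

/-- Finite LOCC protocols on `ℂᵐ ⊗ ℂⁿ` that end by announcing an element of `α`. In each round one
of the two parties measures, and the rest of the protocol may depend on the outcome. -/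
inductive LOCCProtocol (α : Type) : ℕ → ℕ → Type
  | announce {m n : ℕ} (a : α) : LOCCProtocol α m n
  | alice {m n r : ℕ} (d : Fin r → ℕ) (K : (k : Fin r) → Matrix (Fin (d k)) (Fin m) ℂ)
      (hK : IsMeasurement K) (next : (k : Fin r) → LOCCProtocol α (d k) n) : LOCCProtocol α m n
  | bob {m n r : ℕ} (d : Fin r → ℕ) (K : (k : Fin r) → Matrix (Fin (d k)) (Fin n) ℂ)
      (hK : IsMeasurement K) (next : (k : Fin r) → LOCCProtocol α m (d k)) : LOCCProtocol α m n

/-- `P.CanAnnounce ψ a`: when `P` is run on the state `ψ`, it announces `a` with nonzero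
probability. (A sequence of outcomes has nonzero probability exactly when the resulting unnormalized
post-measurement vector is nonzero.) -/
def LOCCProtocol.CanAnnounce {α : Type} :
    {m n : ℕ} → LOCCProtocol α m n → BiState m n → α → Prop
  | _, _, .announce b, ψ, a => ψ ≠ 0 ∧ a = b
  | _, n, .alice _ K _ next, ψ, a =>
      ∃ k, (next k).CanAnnounce ((K k ⊗ₖ (1 : Matrix (Fin n) (Fin n) ℂ)) *ᵥ ψ) a
  | m, _, .bob _ K _ next, ψ, a =>
      ∃ k, (next k).CanAnnounce (((1 : Matrix (Fin m) (Fin m) ℂ) ⊗ₖ K k) *ᵥ ψ) a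

/-- Some LOCC protocol identifies every state of the set with certainty. -/
def LocallyDistinguishable {m n : ℕ} (S : Set (BiState m n)) : Prop :=
  ∃ P : LOCCProtocol (BiState m n) m n, ∀ ψ ∈ S, ∀ a, P.CanAnnounce ψ a → a = ψ

/-- The reduced density operator of the pure state `χ` of `(ℂᵖ ⊗ ℂ^q) ⊗ (ℂʳ ⊗ ℂˢ)`: the partial
trace over the subsystems `ℂ^q` and `ℂˢ`. -/
def reducedState {p q r s : ℕ} (χ : (Fin p × Fin q) × (Fin r × Fin s) → ℂ) :
    Matrix (Fin p × Fin r) (Fin p × Fin r) ℂ :=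
  Matrix.of fun x y => ∑ b, ∑ d, χ ((x.1, b), (x.2, d)) * star (χ ((y.1, b), (y.2, d)))

/-- The set remains orthogonal after one or more subsystems are discarded: after identifying the
local spaces `ℂᵐ` and `ℂⁿ` with `ℂᵖ ⊗ ℂ^q` and `ℂʳ ⊗ ℂˢ` by unitaries, the nontrivial system
`ℂ^q ⊗ ℂˢ` can be traced out so that the reduced states stay mutually orthogonal. -/
def LocallyRedundant {m n : ℕ} (S : Set (BiState m n)) : Prop :=
  ∃ (p q r s : ℕ) (U : Matrix (Fin p × Fin q) (Fin m) ℂ) (V : Matrix (Fin r × Fin s) (Fin n) ℂ),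
    (Uᴴ * U = 1 ∧ U * Uᴴ = 1) ∧ (Vᴴ * V = 1 ∧ V * Vᴴ = 1) ∧ (1 < q ∨ 1 < s) ∧
    S.Pairwise (fun φ ψ =>
      ((reducedState ((U ⊗ₖ V) *ᵥ φ))ᴴ * reducedState ((U ⊗ₖ V) *ᵥ ψ)).trace = 0)

/-- A measurement carried out by one of the two parties alone. -/
def IsLocalMeasurement {m n r : ℕ} (M : Fin r → Matrix (Fin m × Fin n) (Fin m × Fin n) ℂ) : Prop :=
  (∃ K : Fin r → Matrix (Fin m) (Fin m) ℂ, IsMeasurement K ∧ ∀ μ, M μ = K μ ⊗ₖ 1) ∨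
  (∃ K : Fin r → Matrix (Fin n) (Fin n) ℂ, IsMeasurement K ∧ ∀ μ, M μ = 1 ⊗ₖ K μ)

/-- An orthogonality-preserving local measurement for the set `S`. -/
def IsOPLM {m n r : ℕ} (M : Fin r → Matrix (Fin m × Fin n) (Fin m × Fin n) ℂ)
    (S : Set (BiState m n)) : Prop :=
  IsLocalMeasurement M ∧
    ∀ μ, S.Pairwise (fun φ ψ => star (M μ *ᵥ φ) ⬝ᵥ (M μ *ᵥ ψ) = 0)

/-- The set of states that are possible after the outcome with operator `L` has occurred; a state
mapped to zero is ruled out by the outcome. -/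
def postMeasurementSet {m n : ℕ} (L : Matrix (Fin m × Fin n) (Fin m × Fin n) ℂ)
    (S : Set (BiState m n)) : Set (BiState m n) :=
  (fun ψ => L *ᵥ ψ) '' S \ {0}

/-- An orthogonality-preserving local measurement each outcome of which leaves a locally
indistinguishable set, and some outcome of which leaves a set of smaller cardinality. -/
def ActivatesTypeII {m n r : ℕ} (M : Fin r → Matrix (Fin m × Fin n) (Fin m × Fin n) ℂ)
    (S : Set (BiState m n)) : Prop :=
  IsOPLM M S ∧
  (∀ μ, ¬ LocallyDistinguishable (postMeasurementSet (M μ) S)) ∧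
  (∃ μ, (postMeasurementSet (M μ) S).encard < S.encard)

/-- Genuine hidden nonlocality of type II. -/
def HasGenuineHiddenNonlocalityII {m n : ℕ} (S : Set (BiState m n)) : Prop :=
  LocallyDistinguishable S ∧ ¬ LocallyRedundant S ∧
  ∃ (r : ℕ) (M : Fin r → Matrix (Fin m × Fin n) (Fin m × Fin n) ℂ), ActivatesTypeII M S

/-- `f_m = ⌊(m - 1) / 2⌋` (used for `m ≥ 7`). -/
def smallDim (m : ℕ) : ℕ := (m - 1) / 2

/-- `c_m = m - f_m`, the smallest integer larger than `m / 2`. -/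
def largeDim (m : ℕ) : ℕ := m - smallDim m

/-! Split both index ranges into a large and a small block, and put a pinwheel of four tiles on the
boundary of each of the two diagonal rectangles (Alice indexes rows, Bob columns): top row, right
column, bottom row, left column, each side filled with an orthogonal family.

A pinwheel is locally indistinguishable because neither party can make a first move: an operator on
one side that preserves orthogonality is a multiple of the identity (`tileA_rigid`, `tileB_rigid`).
Along a protocol the accumulated operators therefore stay multiples of isometries, nonzero on some
branch, and the leaf of that branch separates nothing (`not_distinguishes_of_locallyRigid`).

To make the set distinguishable, Alice's vectors are extended into her other block by flags, chosen
so that the top row becomes orthogonal to the right column on her side. This breaks the cycle: once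
Bob has told the blocks apart, the sides can be split off one by one
(`locallyDistinguishable_flagged_tile`). Pairs that Bob's vectors do not separate are orthogonal in
each of Alice's blocks separately (`flagged_orthogonal`), so her projection onto the blocks
preserves orthogonality; but it cuts the flags off and leaves one bare pinwheel per outcome,
possibly with further states. The bottom row has zero flags, so the other outcome rules it out.

Irredundancy is a dimension count: vectors that are pairwise non-orthogonal for Bob must occupy
orthogonal subspaces of what Alice keeps, and more than `m / 2` of them leave her nothing to
discard; likewise with the parties exchanged (`not_locallyRedundant`). -/

/-! ### Product vectors -/

/-- The product vector `|a⟩|b⟩`. -/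
def prodState {m n : ℕ} (a : Fin m → ℂ) (b : Fin n → ℂ) : BiState m n := fun x => a x.1 * b x.2

theorem prodState_isProductState {m n : ℕ} (a : Fin m → ℂ) (b : Fin n → ℂ) :
    IsProductState (prodState a b) := ⟨a, b, fun _ _ => rfl⟩

theorem kronecker_mulVec_mul {α β γ δ : Type*} [Fintype β] [Fintype δ]
    (A : Matrix α β ℂ) (B : Matrix γ δ ℂ) (a : β → ℂ) (b : δ → ℂ) :
    (A ⊗ₖ B) *ᵥ (fun x => a x.1 * b x.2) = fun x => (A *ᵥ a) x.1 * (B *ᵥ b) x.2 := by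
  ext ⟨i, j⟩
  simp only [Matrix.mulVec, dotProduct, Fintype.sum_prod_type, Matrix.kroneckerMap_apply,
    Finset.sum_mul_sum]
  exact Finset.sum_congr rfl fun _ _ => Finset.sum_congr rfl fun _ _ => by ring

theorem kronecker_mulVec_prodState {m n m' n' : ℕ} (A : Matrix (Fin m') (Fin m) ℂ)
    (B : Matrix (Fin n') (Fin n) ℂ) (a : Fin m → ℂ) (b : Fin n → ℂ) :
    (A ⊗ₖ B) *ᵥ prodState a b = prodState (A *ᵥ a) (B *ᵥ b) :=
  kronecker_mulVec_mul A B a b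

theorem star_prodState_dotProduct {m n : ℕ} (a a' : Fin m → ℂ) (b b' : Fin n → ℂ) :
    star (prodState a b) ⬝ᵥ prodState a' b' = (star a ⬝ᵥ a') * (star b ⬝ᵥ b') := by
  simp only [dotProduct, Fintype.sum_prod_type, prodState, Finset.sum_mul_sum, Pi.star_apply,
    star_mul']
  exact Finset.sum_congr rfl fun _ _ => Finset.sum_congr rfl fun _ _ => by ring

theorem prodState_zero_left {m n : ℕ} (b : Fin n → ℂ) : prodState (0 : Fin m → ℂ) b = 0 := by
  ext; simp [prodState]

theorem prodState_zero_right {m n : ℕ} (a : Fin m → ℂ) : prodState a (0 : Fin n → ℂ) = 0 := by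
  ext; simp [prodState]

theorem prodState_ne_zero {m n : ℕ} {a : Fin m → ℂ} {b : Fin n → ℂ} (ha : a ≠ 0) (hb : b ≠ 0) :
    prodState a b ≠ 0 := by
  obtain ⟨i, hi⟩ := Function.ne_iff.1 ha
  obtain ⟨j, hj⟩ := Function.ne_iff.1 hb
  exact Function.ne_iff.2 ⟨(i, j), mul_ne_zero hi hj⟩

theorem star_mulVec_dotProduct_mulVec {α β : Type*} [Fintype α] [Fintype β]
    (A : Matrix α β ℂ) (v w : β → ℂ) :
    star (A *ᵥ v) ⬝ᵥ (A *ᵥ w) = star v ⬝ᵥ ((Aᴴ * A) *ᵥ w) := by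
  rw [Matrix.star_mulVec, ← Matrix.dotProduct_mulVec, Matrix.mulVec_mulVec]

open scoped ComplexOrder in
theorem eq_zero_of_star_dotProduct_self {α : Type*} [Fintype α] {v : α → ℂ}
    (h : star v ⬝ᵥ v = 0) : v = 0 :=
  dotProduct_star_self_eq_zero.1 h

/-! ### Local indistinguishability -/

/-- Completeness of the measurement, tensored with the identity; it reduces orthogonality of two
states to orthogonality in every branch. -/
theorem sum_kronecker_one_of_isMeasurement {m n r : ℕ} {d : Fin r → ℕ}
    {K : (k : Fin r) → Matrix (Fin (d k)) (Fin m) ℂ} (hK : IsMeasurement K) (φ ψ : BiState m n) :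
    ∑ k, star ((K k ⊗ₖ (1 : Matrix (Fin n) (Fin n) ℂ)) *ᵥ φ) ⬝ᵥ
      ((K k ⊗ₖ (1 : Matrix (Fin n) (Fin n) ℂ)) *ᵥ ψ) = star φ ⬝ᵥ ψ := by
  simp only [star_mulVec_dotProduct_mulVec, Matrix.conjTranspose_kronecker,
    ← Matrix.mul_kronecker_mul, Matrix.conjTranspose_one, mul_one]
  have h : ∑ k, ((K k)ᴴ * K k) ⊗ₖ (1 : Matrix (Fin n) (Fin n) ℂ) = 1 := by
    rw [← Matrix.one_kronecker_one, ← hK]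
    ext ⟨i, j⟩ ⟨i', j'⟩
    simp [Matrix.sum_apply, Finset.sum_mul]
  rw [← dotProduct_sum, ← Matrix.sum_mulVec, h, Matrix.one_mulVec]

theorem sum_one_kronecker_of_isMeasurement {m n r : ℕ} {d : Fin r → ℕ}
    {K : (k : Fin r) → Matrix (Fin (d k)) (Fin n) ℂ} (hK : IsMeasurement K) (φ ψ : BiState m n) :
    ∑ k, star (((1 : Matrix (Fin m) (Fin m) ℂ) ⊗ₖ K k) *ᵥ φ) ⬝ᵥ
      (((1 : Matrix (Fin m) (Fin m) ℂ) ⊗ₖ K k) *ᵥ ψ) = star φ ⬝ᵥ ψ := by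
  simp only [star_mulVec_dotProduct_mulVec, Matrix.conjTranspose_kronecker,
    ← Matrix.mul_kronecker_mul, Matrix.conjTranspose_one, mul_one]
  have h : ∑ k, (1 : Matrix (Fin m) (Fin m) ℂ) ⊗ₖ ((K k)ᴴ * K k) = 1 := by
    rw [← Matrix.one_kronecker_one, ← hK]
    ext ⟨i, j⟩ ⟨i', j'⟩
    simp [Matrix.sum_apply, Finset.mul_sum]
  rw [← dotProduct_sum, ← Matrix.sum_mulVec, h, Matrix.one_mulVec]

/-- Two vectors that a protocol tells apart with certainty are orthogonal. -/
theorem LOCCProtocol.dotProduct_eq_zero {α : Type} {m n : ℕ} (P : LOCCProtocol α m n)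
    (φ ψ : BiState m n) (h : ∀ t, P.CanAnnounce φ t → ¬ P.CanAnnounce ψ t) :
    star φ ⬝ᵥ ψ = 0 := by
  induction P with
  | announce b =>
    simp only [LOCCProtocol.CanAnnounce] at h
    by_cases hφ : φ = 0
    · simp [hφ]
    by_cases hψ : ψ = 0
    · simp [hψ]
    exact absurd ⟨hψ, rfl⟩ (h b ⟨hφ, rfl⟩)
  | alice d K hK next ih =>
    rw [← sum_kronecker_one_of_isMeasurement hK]
    exact Finset.sum_eq_zero fun k _ => ih k _ _ fun t h₁ h₂ => h t ⟨k, h₁⟩ ⟨k, h₂⟩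
  | bob d K hK next ih =>
    rw [← sum_one_kronecker_of_isMeasurement hK]
    exact Finset.sum_eq_zero fun k _ => ih k _ _ fun t h₁ h₂ => h t ⟨k, h₁⟩ ⟨k, h₂⟩

/-- Only multiples of the identity on the first factor preserve the orthogonality of the product
vectors `a ℓ ⊗ b ℓ`. -/
def LocallyRigid {Λ : Type*} {c e : ℕ} (a : Λ → Fin c → ℂ) (b : Λ → Fin e → ℂ) : Prop :=
  ∀ E : Matrix (Fin c) (Fin c) ℂ,
    (∀ ℓ ℓ', ℓ ≠ ℓ' → (star (a ℓ) ⬝ᵥ (E *ᵥ a ℓ')) * (star (b ℓ) ⬝ᵥ b ℓ') = 0) → ∃ x : ℂ, E = x • 1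

/-- By completeness the scalars `y` of the outcomes sum to `x ≠ 0`, so they cannot all vanish. -/
theorem exists_ne_zero_of_isMeasurement {m c r : ℕ} {d : Fin r → ℕ}
    {K : (k : Fin r) → Matrix (Fin (d k)) (Fin m) ℂ} (hK : IsMeasurement K)
    {A : Matrix (Fin m) (Fin c) ℂ} {x : ℂ} (hx : x ≠ 0) (hA : Aᴴ * A = x • 1) (hc : 0 < c)
    (h : ∀ k, ∃ y : ℂ, (K k * A)ᴴ * (K k * A) = y • 1) :
    ∃ k, ∃ y : ℂ, y ≠ 0 ∧ (K k * A)ᴴ * (K k * A) = y • 1 := by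
  choose y hy using h
  have hsum : ∑ k, (K k * A)ᴴ * (K k * A) = x • 1 := by
    have : ∀ k, (K k * A)ᴴ * (K k * A) = Aᴴ * ((K k)ᴴ * K k) * A := fun k => by
      simp only [Matrix.conjTranspose_mul, Matrix.mul_assoc]
    simp only [this, ← Matrix.sum_mul, ← Matrix.mul_sum]
    rw [show ∑ k, (K k)ᴴ * K k = 1 from hK, Matrix.mul_one, hA]
  by_contra hcon
  push Not at hcon
  have hy0 : ∀ k, y k = 0 := fun k => by
    by_contra h0
    exact hcon k _ h0 (hy k)
  simp only [hy, hy0, zero_smul, Finset.sum_const_zero] at hsum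
  have := congrFun (congrFun hsum ⟨0, hc⟩) ⟨0, hc⟩
  simp at this
  exact hx this.symm

/-- Induction on the protocol, with `A` and `B` the operators accumulated so far. Certain
discrimination forces orthogonality in every branch, rigidity turns this into proportionality to an
isometry, and some outcome has a nonzero factor; the descent follows that outcome. -/
theorem not_distinguishes_of_locallyRigid {α : Type} {Λ : Type*} {c e m n : ℕ}
    {a : Λ → Fin c → ℂ} {b : Λ → Fin e → ℂ} (hab : LocallyRigid a b) (hba : LocallyRigid b a)
    (hc : 0 < c) (he : 0 < e) {i j : Λ} (hij : i ≠ j)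
    (hi : prodState (a i) (b i) ≠ 0) (hj : prodState (a j) (b j) ≠ 0)
    (P : LOCCProtocol α m n) (A : Matrix (Fin m) (Fin c) ℂ) (B : Matrix (Fin n) (Fin e) ℂ)
    {x y : ℂ} (hx : x ≠ 0) (hy : y ≠ 0) (hA : Aᴴ * A = x • 1) (hB : Bᴴ * B = y • 1) :
    ¬ ∀ ℓ ℓ', ℓ ≠ ℓ' → ∀ t, P.CanAnnounce (prodState (A *ᵥ a ℓ) (B *ᵥ b ℓ)) t →
      ¬ P.CanAnnounce (prodState (A *ᵥ a ℓ') (B *ᵥ b ℓ')) t := by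
  -- Nonzero multiples of isometries do not kill states, so at a leaf both `i` and `j` are still
  -- possible and get the same answer.
  have key : ∀ {m' n' : ℕ} (A : Matrix (Fin m') (Fin c) ℂ) (B : Matrix (Fin n') (Fin e) ℂ)
      {x y : ℂ}, x ≠ 0 → y ≠ 0 → Aᴴ * A = x • 1 → Bᴴ * B = y • 1 → ∀ ℓ,
      prodState (a ℓ) (b ℓ) ≠ 0 → prodState (A *ᵥ a ℓ) (B *ᵥ b ℓ) ≠ 0 := by
    intro m' n' A B x y hx hy hA hB ℓ hℓ h0
    have h1 := star_prodState_dotProduct (A *ᵥ a ℓ) (A *ᵥ a ℓ) (B *ᵥ b ℓ) (B *ᵥ b ℓ)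
    rw [h0, dotProduct_zero, star_mulVec_dotProduct_mulVec, star_mulVec_dotProduct_mulVec, hA, hB,
      Matrix.smul_mulVec, Matrix.smul_mulVec, Matrix.one_mulVec, Matrix.one_mulVec,
      dotProduct_smul, dotProduct_smul, smul_eq_mul, smul_eq_mul] at h1
    have h2 : star (prodState (a ℓ) (b ℓ)) ⬝ᵥ prodState (a ℓ) (b ℓ) = 0 := by
      rw [star_prodState_dotProduct]
      have : (x * y) * ((star (a ℓ) ⬝ᵥ a ℓ) * (star (b ℓ) ⬝ᵥ b ℓ)) = 0 := by
        rw [h1]; ring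
      exact (mul_eq_zero.1 this).resolve_left (mul_ne_zero hx hy)
    exact hℓ (eq_zero_of_star_dotProduct_self h2)
  induction P generalizing x y with
  | announce t =>
    intro h
    exact h i j hij t ⟨key A B hx hy hA hB i hi, rfl⟩ ⟨key A B hx hy hA hB j hj, rfl⟩
  | alice d K hK next ih =>
    intro h
    have hk : ∀ k, ∀ ℓ ℓ', ℓ ≠ ℓ' → ∀ t,
        (next k).CanAnnounce (prodState ((K k * A) *ᵥ a ℓ) (B *ᵥ b ℓ)) t →
        ¬ (next k).CanAnnounce (prodState ((K k * A) *ᵥ a ℓ') (B *ᵥ b ℓ')) t := by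
      intro k ℓ ℓ' hne t h₁ h₂
      refine h ℓ ℓ' hne t ⟨k, ?_⟩ ⟨k, ?_⟩ <;>
        simpa only [kronecker_mulVec_prodState, Matrix.mulVec_mulVec, Matrix.one_mul]
    obtain ⟨k, z, hz, hkz⟩ := exists_ne_zero_of_isMeasurement hK hx hA hc fun k => hab _ (by
      intro ℓ ℓ' hne
      have h0 := (next k).dotProduct_eq_zero _ _ (hk k ℓ ℓ' hne)
      rw [star_prodState_dotProduct, star_mulVec_dotProduct_mulVec, star_mulVec_dotProduct_mulVec,
        hB, Matrix.smul_mulVec, Matrix.one_mulVec, dotProduct_smul, smul_eq_mul, mul_left_comm] at h0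
      exact (mul_eq_zero.1 h0).resolve_left hy)
    exact ih k (K k * A) B hz hy hkz hB (hk k)
  | bob d K hK next ih =>
    intro h
    have hk : ∀ k, ∀ ℓ ℓ', ℓ ≠ ℓ' → ∀ t,
        (next k).CanAnnounce (prodState (A *ᵥ a ℓ) ((K k * B) *ᵥ b ℓ)) t →
        ¬ (next k).CanAnnounce (prodState (A *ᵥ a ℓ') ((K k * B) *ᵥ b ℓ')) t := by
      intro k ℓ ℓ' hne t h₁ h₂
      refine h ℓ ℓ' hne t ⟨k, ?_⟩ ⟨k, ?_⟩ <;>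
        simpa only [kronecker_mulVec_prodState, Matrix.mulVec_mulVec, Matrix.one_mul]
    obtain ⟨k, z, hz, hkz⟩ := exists_ne_zero_of_isMeasurement hK hy hB he fun k => hba _ (by
      intro ℓ ℓ' hne
      have h0 := (next k).dotProduct_eq_zero _ _ (hk k ℓ ℓ' hne)
      rw [star_prodState_dotProduct, star_mulVec_dotProduct_mulVec, star_mulVec_dotProduct_mulVec,
        hA, Matrix.smul_mulVec, Matrix.one_mulVec, dotProduct_smul, smul_eq_mul, mul_assoc] at h0
      rw [mul_comm]
      exact (mul_eq_zero.1 h0).resolve_left hx)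
    exact ih k A (K k * B) hx hz hA hkz (hk k)

theorem LocallyDistinguishable.mono {m n : ℕ} {S T : Set (BiState m n)} (hST : S ⊆ T)
    (h : LocallyDistinguishable T) : LocallyDistinguishable S := by
  obtain ⟨P, hP⟩ := h
  exact ⟨P, fun ψ hψ => hP ψ (hST hψ)⟩

/-- A rigid family of product vectors stays locally indistinguishable after it has been embedded
isometrically into a larger space. -/
theorem not_locallyDistinguishable_of_locallyRigid {Λ : Type*} {c e m n : ℕ}
    {a : Λ → Fin c → ℂ} {b : Λ → Fin e → ℂ} (hab : LocallyRigid a b) (hba : LocallyRigid b a)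
    (hc : 0 < c) (he : 0 < e) {i j : Λ} (hij : i ≠ j)
    (hi : prodState (a i) (b i) ≠ 0) (hj : prodState (a j) (b j) ≠ 0)
    (A : Matrix (Fin m) (Fin c) ℂ) (B : Matrix (Fin n) (Fin e) ℂ)
    (hA : Aᴴ * A = 1) (hB : Bᴴ * B = 1) {S : Set (BiState m n)}
    (hinj : Function.Injective fun ℓ => prodState (A *ᵥ a ℓ) (B *ᵥ b ℓ))
    (hS : ∀ ℓ, prodState (A *ᵥ a ℓ) (B *ᵥ b ℓ) ∈ S) :
    ¬ LocallyDistinguishable S := by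
  rintro ⟨P, hP⟩
  refine not_distinguishes_of_locallyRigid hab hba hc he hij hi hj P A B (x := 1) (y := 1)
    one_ne_zero one_ne_zero (by rw [hA, one_smul]) (by rw [hB, one_smul]) ?_
  intro ℓ ℓ' hne t h₁ h₂
  exact hne (hinj ((hP _ (hS ℓ) t h₁).symm.trans (hP _ (hS ℓ') t h₂)))

/-! ### Local distinguishability -/

theorem LOCCProtocol.not_canAnnounce_zero {α : Type} {m n : ℕ} (P : LOCCProtocol α m n) (t : α) :
    ¬ P.CanAnnounce 0 t := by
  induction P with
  | announce b => exact fun h => h.1 rfl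
  | alice d K hK next ih =>
    rintro ⟨k, hk⟩
    rw [Matrix.mulVec_zero] at hk
    exact ih k hk
  | bob d K hK next ih =>
    rintro ⟨k, hk⟩
    rw [Matrix.mulVec_zero] at hk
    exact ih k hk

theorem locallyDistinguishable_of_subset_singleton {m n : ℕ} {S : Set (BiState m n)}
    (ψ : BiState m n) (h : S ⊆ {ψ}) : LocallyDistinguishable S :=
  ⟨.announce ψ, fun _ hφ _ ha => ha.2.trans (h hφ).symm⟩

/-- The orthogonal projection onto the span of a set of vectors, as a matrix. -/
theorem exists_projection {m : ℕ} (T : Set (Fin m → ℂ)) :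
    ∃ Q : Matrix (Fin m) (Fin m) ℂ, Qᴴ = Q ∧ Q * Q = Q ∧ (∀ v ∈ T, Q *ᵥ v = v) ∧
      ∀ w, (∀ v ∈ T, star v ⬝ᵥ w = 0) → Q *ᵥ w = 0 := by
  set W : Submodule ℂ (EuclideanSpace ℂ (Fin m)) := Submodule.span ℂ (WithLp.toLp 2 '' T)
  set Q : Matrix (Fin m) (Fin m) ℂ :=
    (Matrix.toEuclideanCLM (n := Fin m) (𝕜 := ℂ)).symm W.starProjection with hQ
  have hQ' : Matrix.toEuclideanCLM (𝕜 := ℂ) Q = W.starProjection := by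
    rw [hQ]; exact StarAlgEquiv.apply_symm_apply _ _
  have happ : ∀ v : Fin m → ℂ, Q *ᵥ v = (W.starProjection (WithLp.toLp 2 v)).ofLp := by
    intro v
    rw [← hQ', Matrix.toEuclideanCLM_toLp]
  refine ⟨Q, ?_, ?_, ?_, ?_⟩
  · have h := (Matrix.toEuclideanCLM (n := Fin m) (𝕜 := ℂ)).symm.map_star' W.starProjection
    rw [(isSelfAdjoint_starProjection W).star_eq] at h
    exact h.symm
  · rw [hQ, ← map_mul, (Submodule.isIdempotentElem_starProjection W).eq]
  · intro v hv
    rw [happ, Submodule.starProjection_eq_self_iff.2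
      (Submodule.subset_span (Set.mem_image_of_mem _ hv))]
  · intro w hw
    rw [happ, (Submodule.starProjection_apply_eq_zero_iff W).2]
    · rfl
    rw [Submodule.mem_orthogonal]
    intro u hu
    induction hu using Submodule.span_induction with
    | mem x hx =>
      obtain ⟨v, hv, rfl⟩ := hx
      rw [EuclideanSpace.inner_eq_star_dotProduct, dotProduct_comm]
      exact hw v hv
    | zero => simp
    | add x y _ _ hx hy => rw [inner_add_left, hx, hy, add_zero]
    | smul c x _ hx => rw [inner_smul_left, hx, mul_zero]

theorem isMeasurement_projection {m : ℕ} {Q : Matrix (Fin m) (Fin m) ℂ} (h₁ : Qᴴ = Q)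
    (h₂ : Q * Q = Q) :
    IsMeasurement (d := fun _ : Fin 2 => m) (fun k => if k = 0 then Q else 1 - Q) := by
  simp [IsMeasurement, Fin.sum_univ_two, h₁, h₂, Matrix.mul_sub, Matrix.sub_mul]

/-- Alice can separate two parts of a set of product vectors whose vectors on her side are
orthogonal. -/
theorem locallyDistinguishable_union_alice {Λ : Type*} {m n : ℕ} {a : Λ → Fin m → ℂ}
    {b : Λ → Fin n → ℂ} {T T' : Set Λ} (h : ∀ ℓ ∈ T, ∀ ℓ' ∈ T', star (a ℓ) ⬝ᵥ a ℓ' = 0)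
    (hT : LocallyDistinguishable ((fun ℓ => prodState (a ℓ) (b ℓ)) '' T))
    (hT' : LocallyDistinguishable ((fun ℓ => prodState (a ℓ) (b ℓ)) '' T')) :
    LocallyDistinguishable ((fun ℓ => prodState (a ℓ) (b ℓ)) '' (T ∪ T')) := by
  obtain ⟨P, hP⟩ := hT
  obtain ⟨P', hP'⟩ := hT'
  obtain ⟨Q, h₁, h₂, h₃, h₄⟩ := exists_projection (a '' T)
  refine ⟨.alice (fun _ : Fin 2 => m) _ (isMeasurement_projection h₁ h₂)
    (fun k => if k = 0 then P else P'), ?_⟩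
  rintro _ ⟨ℓ, hℓ | hℓ, rfl⟩ t ⟨k, hk⟩
  · have hQ : Q *ᵥ a ℓ = a ℓ := h₃ _ ⟨ℓ, hℓ, rfl⟩
    simp only [kronecker_mulVec_prodState, Matrix.one_mulVec] at hk
    fin_cases k
    · simp only [Fin.zero_eta, if_true, hQ] at hk
      exact hP _ ⟨ℓ, hℓ, rfl⟩ t hk
    · simp only [Fin.mk_one, one_ne_zero, if_false, Matrix.sub_mulVec, Matrix.one_mulVec, hQ,
        sub_self, prodState_zero_left] at hk
      exact absurd hk (LOCCProtocol.not_canAnnounce_zero _ t)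
  · have hQ : Q *ᵥ a ℓ = 0 := h₄ _ (by rintro _ ⟨ℓ', hℓ', rfl⟩; exact h _ hℓ' _ hℓ)
    simp only [kronecker_mulVec_prodState, Matrix.one_mulVec] at hk
    fin_cases k
    · simp only [Fin.zero_eta, if_true, hQ, prodState_zero_left] at hk
      exact absurd hk (LOCCProtocol.not_canAnnounce_zero _ t)
    · simp only [Fin.mk_one, one_ne_zero, if_false, Matrix.sub_mulVec, Matrix.one_mulVec, hQ,
        sub_zero] at hk
      exact hP' _ ⟨ℓ, hℓ, rfl⟩ t hk

/-- Bob can separate two parts of a set of product vectors whose vectors on his side are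
orthogonal. -/
theorem locallyDistinguishable_union_bob {Λ : Type*} {m n : ℕ} {a : Λ → Fin m → ℂ}
    {b : Λ → Fin n → ℂ} {T T' : Set Λ} (h : ∀ ℓ ∈ T, ∀ ℓ' ∈ T', star (b ℓ) ⬝ᵥ b ℓ' = 0)
    (hT : LocallyDistinguishable ((fun ℓ => prodState (a ℓ) (b ℓ)) '' T))
    (hT' : LocallyDistinguishable ((fun ℓ => prodState (a ℓ) (b ℓ)) '' T')) :
    LocallyDistinguishable ((fun ℓ => prodState (a ℓ) (b ℓ)) '' (T ∪ T')) := by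
  obtain ⟨P, hP⟩ := hT
  obtain ⟨P', hP'⟩ := hT'
  obtain ⟨Q, h₁, h₂, h₃, h₄⟩ := exists_projection (b '' T)
  refine ⟨.bob (fun _ : Fin 2 => n) _ (isMeasurement_projection h₁ h₂)
    (fun k => if k = 0 then P else P'), ?_⟩
  rintro _ ⟨ℓ, hℓ | hℓ, rfl⟩ t ⟨k, hk⟩
  · have hQ : Q *ᵥ b ℓ = b ℓ := h₃ _ ⟨ℓ, hℓ, rfl⟩
    simp only [kronecker_mulVec_prodState, Matrix.one_mulVec] at hk
    fin_cases k
    · simp only [Fin.zero_eta, if_true, hQ] at hk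
      exact hP _ ⟨ℓ, hℓ, rfl⟩ t hk
    · simp only [Fin.mk_one, one_ne_zero, if_false, Matrix.sub_mulVec, Matrix.one_mulVec, hQ,
        sub_self, prodState_zero_right] at hk
      exact absurd hk (LOCCProtocol.not_canAnnounce_zero _ t)
  · have hQ : Q *ᵥ b ℓ = 0 := h₄ _ (by rintro _ ⟨ℓ', hℓ', rfl⟩; exact h _ hℓ' _ hℓ)
    simp only [kronecker_mulVec_prodState, Matrix.one_mulVec] at hk
    fin_cases k
    · simp only [Fin.zero_eta, if_true, hQ, prodState_zero_right] at hk
      exact absurd hk (LOCCProtocol.not_canAnnounce_zero _ t)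
    · simp only [Fin.mk_one, one_ne_zero, if_false, Matrix.sub_mulVec, Matrix.one_mulVec, hQ,
        sub_zero] at hk
      exact hP' _ ⟨ℓ, hℓ, rfl⟩ t hk

/-- Alice splits off one vector at a time. -/
theorem locallyDistinguishable_of_orthogonal_alice {Λ : Type*} [Finite Λ] {m n : ℕ}
    {a : Λ → Fin m → ℂ} {b : Λ → Fin n → ℂ} {T : Set Λ}
    (h : T.Pairwise fun ℓ ℓ' => star (a ℓ) ⬝ᵥ a ℓ' = 0) :
    LocallyDistinguishable ((fun ℓ => prodState (a ℓ) (b ℓ)) '' T) := by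
  induction T, T.toFinite using Set.Finite.induction_on with
  | empty => exact locallyDistinguishable_of_subset_singleton 0 (by simp)
  | @insert ℓ T hℓ _ ih =>
    rw [Set.insert_eq]
    refine locallyDistinguishable_union_alice ?_
      (locallyDistinguishable_of_subset_singleton (prodState (a ℓ) (b ℓ)) (by simp))
      (ih (h.mono (Set.subset_insert _ _)))
    rintro _ rfl ℓ' hℓ'
    exact h (Set.mem_insert _ _) (Set.mem_insert_of_mem _ hℓ') (by rintro rfl; exact hℓ hℓ')

theorem locallyDistinguishable_of_orthogonal_bob {Λ : Type*} [Finite Λ] {m n : ℕ}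
    {a : Λ → Fin m → ℂ} {b : Λ → Fin n → ℂ} {T : Set Λ}
    (h : T.Pairwise fun ℓ ℓ' => star (b ℓ) ⬝ᵥ b ℓ' = 0) :
    LocallyDistinguishable ((fun ℓ => prodState (a ℓ) (b ℓ)) '' T) := by
  induction T, T.toFinite using Set.Finite.induction_on with
  | empty => exact locallyDistinguishable_of_subset_singleton 0 (by simp)
  | @insert ℓ T hℓ _ ih =>
    rw [Set.insert_eq]
    refine locallyDistinguishable_union_bob ?_
      (locallyDistinguishable_of_subset_singleton (prodState (a ℓ) (b ℓ)) (by simp))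
      (ih (h.mono (Set.subset_insert _ _)))
    rintro _ rfl ℓ' hℓ'
    exact h (Set.mem_insert _ _) (Set.mem_insert_of_mem _ hℓ') (by rintro rfl; exact hℓ hℓ')

/-! ### Local irredundancy -/

-- The trace is the squared Hilbert–Schmidt norm of `Xᴴ * Y`.
open scoped ComplexOrder in
theorem trace_gram_mul_gram_eq_zero_iff {p q : ℕ} (X Y : Matrix (Fin p) (Fin q) ℂ) :
    ((X * Xᴴ)ᴴ * (Y * Yᴴ)).trace = 0 ↔ Xᴴ * Y = 0 := by
  rw [← Matrix.trace_mul_conjTranspose_self_eq_zero_iff]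
  rw [Matrix.conjTranspose_mul, Matrix.conjTranspose_conjTranspose, Matrix.mul_assoc,
    Matrix.trace_mul_comm, Matrix.conjTranspose_mul, Matrix.conjTranspose_conjTranspose]
  simp only [Matrix.mul_assoc]

/-- A vector of `ℂᵖ ⊗ ℂ^q` read as a `p × q` matrix `X` has reduced state `X * Xᴴ`; a product vector
reduces on each side independently. -/
theorem reducedState_mul {p q r s : ℕ} (x : Fin p × Fin q → ℂ) (y : Fin r × Fin s → ℂ) :
    reducedState (fun z => x z.1 * y z.2) =
      (Matrix.of (Function.curry x) * (Matrix.of (Function.curry x))ᴴ) ⊗ₖ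
        (Matrix.of (Function.curry y) * (Matrix.of (Function.curry y))ᴴ) := by
  ext ⟨i, j⟩ ⟨i', j'⟩
  simp only [reducedState, Matrix.of_apply, Matrix.kroneckerMap_apply, Matrix.mul_apply,
    Matrix.conjTranspose_apply, Function.curry_apply, Finset.sum_mul_sum, star_mul']
  exact Finset.sum_congr rfl fun _ _ => Finset.sum_congr rfl fun _ _ => by ring

/-- One nonzero column from each block gives orthogonal, hence linearly independent, vectors of
`ℂᵖ`. -/
theorem card_le_of_orthogonal_blocks {ι : Type*} [Fintype ι] {p q : ℕ}
    (X : ι → Matrix (Fin p) (Fin q) ℂ) (h0 : ∀ i, X i ≠ 0)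
    (h : ∀ i j, i ≠ j → (X i)ᴴ * X j = 0) : Fintype.card ι ≤ p := by
  have : ∀ i, ∃ k, (X i)ᵀ k ≠ 0 := by
    intro i
    by_contra! hc
    exact h0 i (by ext x y; exact congrFun (hc y) x)
  choose k hk using this
  have hli : LinearIndependent ℂ (fun i => (WithLp.toLp 2 ((X i)ᵀ (k i)) :
      EuclideanSpace ℂ (Fin p))) := by
    refine linearIndependent_of_ne_zero_of_inner_eq_zero (𝕜 := ℂ) (fun i hi => hk i ?_) ?_
    · simpa using hi
    · intro i j hij
      rw [EuclideanSpace.inner_eq_star_dotProduct, dotProduct_comm]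
      have := congrFun (congrFun (h i j hij) (k i)) (k j)
      simpa [Matrix.mul_apply, dotProduct] using this
  simpa using hli.fintype_card_le_finrank

theorem mul_eq_of_unitary {p q m : ℕ} {U : Matrix (Fin p × Fin q) (Fin m) ℂ}
    (h₁ : Uᴴ * U = 1) (h₂ : U * Uᴴ = 1) : p * q = m := by
  have h := congrArg Matrix.trace h₁
  rw [Matrix.trace_mul_comm, h₂, Matrix.trace_one, Matrix.trace_one] at h
  simpa using (by exact_mod_cast h : Fintype.card (Fin p × Fin q) = Fintype.card (Fin m))

/-- Used contrapositively: vectors that are not orthogonal have a nonzero block product, so the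
other party's blocks must be the orthogonal ones. -/
theorem star_dotProduct_eq_trace {p q m : ℕ} {U : Matrix (Fin p × Fin q) (Fin m) ℂ}
    (h : Uᴴ * U = 1) (v w : Fin m → ℂ) :
    star v ⬝ᵥ w =
      ((Matrix.of (Function.curry (U *ᵥ v)))ᴴ * Matrix.of (Function.curry (U *ᵥ w))).trace := by
  have h₁ := star_mulVec_dotProduct_mulVec U v w
  rw [h, Matrix.one_mulVec] at h₁
  rw [← h₁]
  simp only [dotProduct, Fintype.sum_prod_type, Matrix.trace, Matrix.diag, Matrix.mul_apply,
    Matrix.conjTranspose_apply, Matrix.of_apply, Function.curry_apply, Pi.star_apply]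
  exact Finset.sum_comm

/-- With `N` the number of vectors, `p * q = m < 2 * N ≤ 2 * p`. -/
theorem le_one_of_orthogonal_blocks {ι : Type*} [Fintype ι] {p q m : ℕ}
    {U : Matrix (Fin p × Fin q) (Fin m) ℂ} (h₁ : Uᴴ * U = 1) (h₂ : U * Uᴴ = 1)
    (a : ι → Fin m → ℂ) (ha : ∀ i, a i ≠ 0) (hm : m < 2 * Fintype.card ι)
    (h : ∀ i j, i ≠ j → (Matrix.of (Function.curry (U *ᵥ a i)))ᴴ *
      Matrix.of (Function.curry (U *ᵥ a j)) = 0) : q ≤ 1 := by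
  have hp := card_le_of_orthogonal_blocks (fun i => Matrix.of (Function.curry (U *ᵥ a i))) (by
    intro i h0
    refine ha i (eq_zero_of_star_dotProduct_self ?_)
    rw [star_dotProduct_eq_trace h₁, h0]
    simp) h
  have hpq := mul_eq_of_unitary h₁ h₂
  by_contra! hq
  nlinarith

/-- A set of product vectors is locally irredundant if, for each party, it contains a family of
more than half as many vectors as the dimension of this party's space, no two of which are
orthogonal on the side of the other party. -/
theorem not_locallyRedundant {Λ ι κ : Type*} [Fintype ι] [Fintype κ] {m n : ℕ}
    {a : Λ → Fin m → ℂ} {b : Λ → Fin n → ℂ}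
    (hinj : Function.Injective fun ℓ => prodState (a ℓ) (b ℓ))
    (ha : ∀ ℓ, a ℓ ≠ 0) (hb : ∀ ℓ, b ℓ ≠ 0)
    (f : ι → Λ) (hf : Function.Injective f) (hm : m < 2 * Fintype.card ι)
    (hfb : ∀ i j, i ≠ j → star (b (f i)) ⬝ᵥ b (f j) ≠ 0)
    (g : κ → Λ) (hg : Function.Injective g) (hn : n < 2 * Fintype.card κ)
    (hga : ∀ i j, i ≠ j → star (a (g i)) ⬝ᵥ a (g j) ≠ 0) :
    ¬ LocallyRedundant (Set.range fun ℓ => prodState (a ℓ) (b ℓ)) := by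
  rintro ⟨p, q, r, s, U, V, ⟨hU₁, hU₂⟩, ⟨hV₁, hV₂⟩, hqs, h⟩
  have key : ∀ ℓ ℓ', ℓ ≠ ℓ' →
      (Matrix.of (Function.curry (U *ᵥ a ℓ)))ᴴ * Matrix.of (Function.curry (U *ᵥ a ℓ')) = 0 ∨
      (Matrix.of (Function.curry (V *ᵥ b ℓ)))ᴴ * Matrix.of (Function.curry (V *ᵥ b ℓ')) = 0 := by
    intro ℓ ℓ' hne
    have h₁ := h ⟨ℓ, rfl⟩ ⟨ℓ', rfl⟩ (fun he => hne (hinj he))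
    have hk : ∀ ℓ, (U ⊗ₖ V) *ᵥ prodState (a ℓ) (b ℓ) = fun x => (U *ᵥ a ℓ) x.1 * (V *ᵥ b ℓ) x.2 :=
      fun ℓ => kronecker_mulVec_mul U V (a ℓ) (b ℓ)
    beta_reduce at h₁
    rw [hk, hk, reducedState_mul, reducedState_mul,
      Matrix.conjTranspose_kronecker, ← Matrix.mul_kronecker_mul, Matrix.trace_kronecker,
      mul_eq_zero, trace_gram_mul_gram_eq_zero_iff, trace_gram_mul_gram_eq_zero_iff] at h₁
    exact h₁
  have hq : q ≤ 1 := le_one_of_orthogonal_blocks hU₁ hU₂ (fun i => a (f i)) (fun _ => ha _) hm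
    fun i j hij => (key _ _ (hf.ne hij)).resolve_right fun h0 => hfb i j hij (by
      rw [star_dotProduct_eq_trace hV₁, h0, Matrix.trace_zero])
  have hs : s ≤ 1 := le_one_of_orthogonal_blocks hV₁ hV₂ (fun i => b (g i)) (fun _ => hb _) hn
    fun i j hij => (key _ _ (hg.ne hij)).resolve_left fun h0 => hga i j hij (by
      rw [star_dotProduct_eq_trace hU₁, h0, Matrix.trace_zero])
  omega

/-! ### An orthogonal basis without zero entries -/

/-- The vectors `K e_j + (i - 1) ∑ₖ eₖ` of `ℂᴷ`. -/
noncomputable def spread {K : ℕ} (j : Fin K) : Fin K → ℂ :=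
  fun i => (if i = j then (K : ℂ) else 0) + (Complex.I - 1)

/-- Every entry has imaginary part `1`. The nonzero real choice `-2` for the constant would also
give orthogonality, but the entry `K - 2` vanishes for `K = 2`. -/
theorem spread_ne_zero {K : ℕ} (j i : Fin K) : spread j i ≠ 0 := by
  intro h
  have := congrArg Complex.im h
  unfold spread at this
  split_ifs at this <;> simp at this

/-- The constant `z = i - 1` satisfies `|z|² + 2 Re z = 0`, which cancels all terms but `K²` on the
diagonal. -/
theorem star_spread_dotProduct {K : ℕ} (j k : Fin K) :
    star (spread j) ⬝ᵥ spread k = if j = k then (K : ℂ) ^ 2 else 0 := by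
  have h : ∀ i, star (spread j) i * spread k i =
      (if i = j then (if j = k then (K : ℂ) ^ 2 else 0) else 0) +
      (if i = j then (K : ℂ) * (Complex.I - 1) else 0) +
      (if i = k then (K : ℂ) * (-Complex.I - 1) else 0) + 2 := by
    intro i
    have hI := Complex.I_sq
    simp only [spread, Pi.star_apply, star_add, star_sub, star_one, Complex.star_def,
      Complex.conj_I, apply_ite (starRingEnd ℂ), map_natCast, map_zero]
    by_cases hj : i = j
    · subst hj
      by_cases hk : i = k
      · subst hk; simp only [if_true]; linear_combination -hI
      · simp only [if_true, if_neg hk]; linear_combination -hI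
    · simp only [if_neg hj]
      by_cases hk : i = k
      · simp only [if_pos hk]; linear_combination -hI
      · simp only [if_neg hk]; linear_combination -hI
  simp only [dotProduct, h, Finset.sum_add_distrib, Finset.sum_ite_eq', Finset.mem_univ, if_true,
    Finset.sum_const, Finset.card_univ, Fintype.card_fin, nsmul_eq_mul]
  ring

/-- A matrix that is diagonal in the basis `spread` and has an eigenvector in the standard basis is
a multiple of the identity. -/
theorem eq_smul_one_of_spread {K : ℕ} (E : Matrix (Fin K) (Fin K) ℂ) (t : Fin K)
    (h : ∀ j k, j ≠ k → star (spread j) ⬝ᵥ (E *ᵥ spread k) = 0) (ht : ∀ i, i ≠ t → E t i = 0) :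
    E = E t t • 1 := by
  have hK : (K : ℂ) ^ 2 ≠ 0 := by
    have : K ≠ 0 := fun h0 => by subst h0; exact t.elim0
    positivity
  set F : Matrix (Fin K) (Fin K) ℂ := Matrix.of fun i j => spread j i with hF
  have h₁ : Fᴴ * F = (K : ℂ) ^ 2 • 1 := by
    ext j k
    have := star_spread_dotProduct j k
    simpa [Matrix.mul_apply, hF, dotProduct, Matrix.one_apply] using this
  have h₂ : F * Fᴴ = (K : ℂ) ^ 2 • 1 := by
    have h3 : (((K : ℂ) ^ 2)⁻¹ • Fᴴ) * F = 1 := by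
      rw [Matrix.smul_mul, h₁, smul_smul, inv_mul_cancel₀ hK, one_smul]
    have h4 := mul_eq_one_comm.1 h3
    rw [Matrix.mul_smul] at h4
    rw [← h4, smul_smul, mul_inv_cancel₀ hK, one_smul]
  have hD : ∀ j k, j ≠ k → (Fᴴ * E * F) j k = 0 := by
    intro j k hjk
    have := h j k hjk
    rw [Matrix.mul_assoc]
    simpa [Matrix.mul_apply, hF, dotProduct, Matrix.mulVec] using this
  have hEF : (K : ℂ) ^ 2 • (E * F) = F * (Fᴴ * E * F) := by
    rw [Matrix.mul_assoc Fᴴ, ← Matrix.mul_assoc F, h₂, Matrix.smul_mul, Matrix.one_mul]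
  have hdiag : Fᴴ * E * F = ((K : ℂ) ^ 2 * E t t) • 1 := by
    ext j k
    by_cases hjk : j = k
    · subst hjk
      -- Row `t` of `K² E F = F D`, with `D = Fᴴ E F` diagonal, reads `K² E t t F t j = F t j D j
      -- j`. As `F t j ≠ 0`, all eigenvalues agree.
      have h5 := congrFun (congrFun hEF t) j
      rw [Matrix.smul_apply, Matrix.mul_apply, Matrix.mul_apply,
        Finset.sum_eq_single t (fun i _ hi => by rw [ht i hi, zero_mul]) (by simp),
        Finset.sum_eq_single j (fun i _ hi => by rw [hD i j hi, mul_zero]) (by simp)] at h5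
      have hne : F t j ≠ 0 := spread_ne_zero j t
      rw [Matrix.smul_apply, Matrix.one_apply_eq, smul_eq_mul, mul_one]
      apply mul_left_cancel₀ hne
      rw [← h5, smul_eq_mul]; ring
    · rw [hD j k hjk, Matrix.smul_apply, Matrix.one_apply_ne hjk, smul_zero]
  have h6 : F * (Fᴴ * E * F) * Fᴴ = ((K : ℂ) ^ 2 * (K : ℂ) ^ 2) • E := by
    rw [← hEF, Matrix.smul_mul, Matrix.mul_assoc, h₂, Matrix.mul_smul, Matrix.mul_one, smul_smul]
  rw [hdiag, Matrix.mul_smul, Matrix.mul_one, Matrix.smul_mul, h₂, smul_smul] at h6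
  have h7 : ((K : ℂ) ^ 2 * (K : ℂ) ^ 2) • E = ((K : ℂ) ^ 2 * (K : ℂ) ^ 2) • (E t t • 1) := by
    rw [← h6, smul_smul]; congr 1; ring
  exact smul_right_injective _ (mul_ne_zero hK hK) h7

/-! ### Vectors supported away from one end of the index range -/

/-- Extension by `0` in the last place. -/
def low {K : ℕ} (v : Fin K → ℂ) : Fin (K + 1) → ℂ := Fin.snoc (α := fun _ => ℂ) v 0

/-- Extension by `0` in the first place. -/
def high {K : ℕ} (v : Fin K → ℂ) : Fin (K + 1) → ℂ := Fin.cons (α := fun _ => ℂ) 0 v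

theorem low_castSucc {K : ℕ} (v : Fin K → ℂ) (i : Fin K) : low v i.castSucc = v i := by
  simp [low]

theorem low_last {K : ℕ} (v : Fin K → ℂ) : low v (Fin.last K) = 0 := by
  simp [low]

theorem low_zero {K : ℕ} (v : Fin (K + 1) → ℂ) : low v 0 = v 0 := low_castSucc v 0

theorem high_succ {K : ℕ} (v : Fin K → ℂ) (i : Fin K) : high v i.succ = v i := by
  simp [high]

theorem high_zero {K : ℕ} (v : Fin K → ℂ) : high v 0 = 0 := by
  simp [high]

theorem high_last {K : ℕ} (v : Fin (K + 1) → ℂ) : high v (Fin.last _) = v (Fin.last K) := by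
  rw [← Fin.succ_last, high_succ]

theorem star_low_dotProduct {K : ℕ} (v : Fin K → ℂ) (w : Fin (K + 1) → ℂ) :
    star (low v) ⬝ᵥ w = star v ⬝ᵥ fun i => w i.castSucc := by
  simp [dotProduct, Fin.sum_univ_castSucc, low_castSucc, low_last]

theorem star_high_dotProduct {K : ℕ} (v : Fin K → ℂ) (w : Fin (K + 1) → ℂ) :
    star (high v) ⬝ᵥ w = star v ⬝ᵥ fun i => w i.succ := by
  simp [dotProduct, Fin.sum_univ_succ, high_succ, high_zero]

theorem mulVec_low {K : ℕ} {α : Type*} (E : Matrix α (Fin (K + 1)) ℂ) (v : Fin K → ℂ) :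
    E *ᵥ low v = E.submatrix id Fin.castSucc *ᵥ v := by
  ext i; simp [Matrix.mulVec, dotProduct, Fin.sum_univ_castSucc, low_castSucc, low_last]

theorem mulVec_high {K : ℕ} {α : Type*} (E : Matrix α (Fin (K + 1)) ℂ) (v : Fin K → ℂ) :
    E *ᵥ high v = E.submatrix id Fin.succ *ᵥ v := by
  ext i; simp [Matrix.mulVec, dotProduct, Fin.sum_univ_succ, high_succ, high_zero]

theorem star_low_dotProduct_mulVec_low {K : ℕ} (E : Matrix (Fin (K + 1)) (Fin (K + 1)) ℂ)
    (v w : Fin K → ℂ) :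
    star (low v) ⬝ᵥ (E *ᵥ low w) = star v ⬝ᵥ (E.submatrix Fin.castSucc Fin.castSucc *ᵥ w) := by
  rw [star_low_dotProduct, mulVec_low]; rfl

theorem star_high_dotProduct_mulVec_high {K : ℕ} (E : Matrix (Fin (K + 1)) (Fin (K + 1)) ℂ)
    (v w : Fin K → ℂ) :
    star (high v) ⬝ᵥ (E *ᵥ high w) = star v ⬝ᵥ (E.submatrix Fin.succ Fin.succ *ᵥ w) := by
  rw [star_high_dotProduct, mulVec_high]; rfl

theorem star_low_dotProduct_low {K : ℕ} (v w : Fin K → ℂ) :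
    star (low v) ⬝ᵥ low w = star v ⬝ᵥ w := by
  rw [star_low_dotProduct]; simp only [low_castSucc]

theorem star_high_dotProduct_high {K : ℕ} (v w : Fin K → ℂ) :
    star (high v) ⬝ᵥ high w = star v ⬝ᵥ w := by
  rw [star_high_dotProduct]; simp only [high_succ]

theorem star_single_dotProduct {K : ℕ} (i : Fin K) (w : Fin K → ℂ) :
    star (Pi.single i (1 : ℂ)) ⬝ᵥ w = w i := by
  rw [Pi.star_single, star_one, single_one_dotProduct]

theorem star_dotProduct_single {K : ℕ} (i : Fin K) (w : Fin K → ℂ) :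
    star w ⬝ᵥ Pi.single i (1 : ℂ) = star (w i) := by
  rw [dotProduct_single_one, Pi.star_apply]

theorem star_dotProduct_eq_zero_comm {α : Type*} [Fintype α] {v w : α → ℂ} :
    star v ⬝ᵥ w = 0 ↔ star w ⬝ᵥ v = 0 := by
  rw [← star_eq_zero, Matrix.star_dotProduct, star_star]

/-- A linear functional that vanishes on an orthogonal basis `spread` vanishes. -/
theorem eq_zero_of_dotProduct_spread {K : ℕ} {x : Fin K → ℂ}
    (h : ∀ j, x ⬝ᵥ spread j = 0) : x = 0 := by
  have hI : ∀ j, (K : ℂ) * x j + (Complex.I - 1) * ∑ i, x i = 0 := by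
    intro j
    have := h j
    simp only [dotProduct, spread, mul_add, Finset.sum_add_distrib, mul_ite, mul_zero,
      Finset.sum_ite_eq', Finset.mem_univ, if_true] at this
    rw [← Finset.sum_mul] at this
    linear_combination this
  have hs := Finset.sum_congr (rfl : (Finset.univ : Finset (Fin K)) = _) fun j _ => hI j
  rw [Finset.sum_add_distrib, ← Finset.mul_sum, Finset.sum_const, Finset.card_univ,
    Fintype.card_fin, nsmul_eq_mul, Finset.sum_const_zero] at hs
  ext j
  have hK : (K : ℂ) ≠ 0 := by
    have : K ≠ 0 := fun h0 => by subst h0; exact j.elim0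
    exact_mod_cast this
  -- Summing the `K` equations gives `K + K (i - 1) = K i` times the total.
  have hs' : (K : ℂ) * Complex.I * ∑ i, x i = 0 := by linear_combination hs
  have h0 : ∑ i, x i = 0 :=
    (mul_eq_zero.1 hs').resolve_left (mul_ne_zero hK Complex.I_ne_zero)
  have := hI j
  rw [h0, mul_zero, add_zero] at this
  exact (mul_eq_zero.1 this).resolve_left hK

theorem eq_zero_of_star_spread_dotProduct {K : ℕ} {x : Fin K → ℂ}
    (h : ∀ j, star (spread j) ⬝ᵥ x = 0) : x = 0 := by
  have : star x = 0 := eq_zero_of_dotProduct_spread fun j => star_dotProduct_eq_zero_comm.1 (h j)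
  simpa using this

/-! ### Dominoes -/

/-- The entries of the orthogonal family `e₀ + e₁, e₀ - e₁, e₂, e₃, …`. -/
def dominoEntry (k i : ℕ) : ℂ :=
  if k < 2 ∧ i < 2 then (if k = 1 ∧ i = 1 then -1 else 1) else if i = k then 1 else 0

/-- The orthogonal family `e₀ + e₁, e₀ - e₁, e₂, e₃, …`. -/
def domino {p : ℕ} (k : Fin (p + 2)) : Fin (p + 2) → ℂ := fun i => dominoEntry k i

/-- The family `-(e₀ + e₁), -(e₀ - e₁), 0, 0, …`. -/
def dominoFlag {p f : ℕ} (k : Fin (p + 2)) : Fin (f + 3) → ℂ :=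
  fun i => if k.val < 2 ∧ i.val < 2 then -dominoEntry k i else 0

theorem star_dominoEntry (k i : ℕ) : star (dominoEntry k i) = dominoEntry k i := by
  unfold dominoEntry; split_ifs <;> simp

theorem dominoEntry_sum_two {j k : ℕ} (h : j ≠ k) :
    dominoEntry j 0 * dominoEntry k 0 + dominoEntry j 1 * dominoEntry k 1 = 0 := by
  unfold dominoEntry
  rcases j with _ | _ | j <;> rcases k with _ | _ | k <;> simp_all

theorem dominoEntry_add_two (k i : ℕ) : dominoEntry k (i + 2) = if i + 2 = k then 1 else 0 := by
  rw [dominoEntry, if_neg (by omega)]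

theorem dominoEntry_mul_eq_zero {j k i : ℕ} (h : j ≠ k) :
    dominoEntry j (i + 2) * dominoEntry k (i + 2) = 0 := by
  simp only [dominoEntry_add_two]
  split_ifs <;> first | omega | simp

theorem star_domino_dotProduct {p : ℕ} {j k : Fin (p + 2)} (h : j ≠ k) :
    star (domino j) ⬝ᵥ domino k = 0 := by
  have h' : j.val ≠ k.val := fun e => h (Fin.ext e)
  simp only [dotProduct, Pi.star_apply, domino, star_dominoEntry]
  rw [Fin.sum_univ_succ, Fin.sum_univ_succ, ← add_assoc]
  simp only [Fin.val_zero, Fin.val_succ, zero_add, dominoEntry_sum_two h']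
  exact Finset.sum_eq_zero fun i _ => dominoEntry_mul_eq_zero h'

/-- Only the two dominoes that touch index `0` need flags, so two further dimensions suffice. With
`spread` all `p + 2` vectors would need orthogonal nonzero flags, possibly too many for the other
block. -/
theorem star_dominoFlag_dotProduct {p f : ℕ} {j k : Fin (p + 2)} (h : j ≠ k) :
    star (dominoFlag j : Fin (f + 3) → ℂ) ⬝ᵥ dominoFlag k = 0 := by
  have h' : j.val ≠ k.val := fun e => h (Fin.ext e)
  by_cases hj : j.val < 2
  · by_cases hk : k.val < 2
    · simp only [dotProduct, Pi.star_apply, dominoFlag, hj, hk, true_and]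
      rw [Fin.sum_univ_succ, Fin.sum_univ_succ, ← add_assoc]
      simp [star_dominoEntry, dominoEntry_sum_two h']
    · have : (dominoFlag k : Fin (f + 3) → ℂ) = 0 := by ext; simp [dominoFlag, hk]
      simp [this]
  · have : (dominoFlag j : Fin (f + 3) → ℂ) = 0 := by ext; simp [dominoFlag, hj]
    simp [this]

/-- The cancellation that makes the flagged top row `e₀ ⊕ e₀` orthogonal to the flagged right
column. -/
theorem domino_zero_add_dominoFlag_zero {p f : ℕ} (k : Fin (p + 2)) :
    domino k 0 + (dominoFlag k : Fin (f + 3) → ℂ) 0 = 0 := by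
  by_cases hk : k.val < 2
  · simp [domino, dominoFlag, hk]
  · have : k.val ≠ 0 := by omega
    simp [domino, dominoFlag, dominoEntry, hk, Ne.symm this]

theorem domino_self {p : ℕ} (k : Fin (p + 2)) : domino k k ≠ 0 := by
  simp only [domino, dominoEntry]
  split_ifs <;> simp_all

theorem domino_zero_eq {p : ℕ} :
    (domino 0 : Fin (p + 2) → ℂ) = Pi.single 0 1 + Pi.single 1 1 := by
  ext i
  refine Fin.cases ?_ (fun i => Fin.cases ?_ (fun i => ?_) i) i
  · simp [domino, dominoEntry]
  · simp [domino, dominoEntry]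
  · simp [domino, dominoEntry, Fin.ext_iff]

theorem domino_one_eq {p : ℕ} :
    (domino 1 : Fin (p + 2) → ℂ) = Pi.single 0 1 - Pi.single 1 1 := by
  ext i
  refine Fin.cases ?_ (fun i => Fin.cases ?_ (fun i => ?_) i) i
  · simp [domino, dominoEntry]
  · simp [domino, dominoEntry]
  · simp [domino, dominoEntry, Fin.ext_iff]

theorem domino_succ_succ_eq {p : ℕ} (k : Fin p) :
    (domino k.succ.succ : Fin (p + 2) → ℂ) = Pi.single k.succ.succ 1 := by
  ext i
  simp [domino, dominoEntry, Pi.single_apply, Fin.ext_iff]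

/-! ### The boundary tiling -/

/-- Labels of the product vectors on the boundary of a `(p + 3) × (q + 3)` rectangle. -/
abbrev Tile (p q : ℕ) : Type := (Fin (q + 2) ⊕ Fin (p + 2)) ⊕ (Fin (q + 2) ⊕ Fin (p + 2))

/-- Alice's part of the vectors of the boundary tiling. -/
noncomputable def tileA {p q : ℕ} : Tile p q → Fin (p + 3) → ℂ
  | .inl (.inl _) => Pi.single 0 1
  | .inl (.inr k) => low (domino k)
  | .inr (.inl _) => Pi.single (Fin.last _) 1
  | .inr (.inr k) => high (spread k)

/-- Bob's part of the vectors of the boundary tiling. -/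
noncomputable def tileB {p q : ℕ} : Tile p q → Fin (q + 3) → ℂ
  | .inl (.inl j) => low (spread j)
  | .inl (.inr _) => Pi.single (Fin.last _) 1
  | .inr (.inl j) => high (spread j)
  | .inr (.inr _) => Pi.single 0 1

/-- The vectors added on Alice's side, in further dimensions, to make the boundary tiling locally
distinguishable. -/
noncomputable def tileFlag {p q f : ℕ} : Tile p q → Fin (f + 3) → ℂ
  | .inl (.inl _) => Pi.single 0 1
  | .inl (.inr k) => dominoFlag k
  | .inr _ => 0

theorem tileA_ne_zero {p q : ℕ} (ℓ : Tile p q) : tileA ℓ ≠ 0 := by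
  rcases ℓ with (j | k) | (j | k)
  · exact Function.ne_iff.2 ⟨0, by simp [tileA]⟩
  · exact Function.ne_iff.2 ⟨k.castSucc, by simpa [tileA, low_castSucc] using domino_self k⟩
  · exact Function.ne_iff.2 ⟨Fin.last _, by simp [tileA]⟩
  · exact Function.ne_iff.2 ⟨k.succ, by simpa [tileA, high_succ] using spread_ne_zero k k⟩

theorem tileB_ne_zero {p q : ℕ} (ℓ : Tile p q) : tileB ℓ ≠ 0 := by
  rcases ℓ with (j | k) | (j | k)
  · exact Function.ne_iff.2 ⟨j.castSucc, by simpa [tileB, low_castSucc] using spread_ne_zero j j⟩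
  · exact Function.ne_iff.2 ⟨Fin.last _, by simp [tileB]⟩
  · exact Function.ne_iff.2 ⟨j.succ, by simpa [tileB, high_succ] using spread_ne_zero j j⟩
  · exact Function.ne_iff.2 ⟨0, by simp [tileB]⟩

theorem star_spread_dotProduct_of_ne {K : ℕ} {j k : Fin K} (h : j ≠ k) :
    star (spread j) ⬝ᵥ spread k = 0 := by
  rw [star_spread_dotProduct, if_neg h]

/-- Two different vectors of the tiling are orthogonal on Bob's side, or they are orthogonal on
Alice's side, both with and without flags. -/
theorem tile_orthogonal {p q f : ℕ} {ℓ ℓ' : Tile p q} (h : ℓ ≠ ℓ') :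
    star (tileB ℓ) ⬝ᵥ tileB ℓ' = 0 ∨ (star (tileA ℓ) ⬝ᵥ tileA ℓ' = 0 ∧
      star (tileFlag ℓ : Fin (f + 3) → ℂ) ⬝ᵥ tileFlag ℓ' = 0) := by
  rcases ℓ with (j | k) | (j | k) <;> rcases ℓ' with (j' | k') | (j' | k')
  · left
    exact (star_low_dotProduct_low _ _).trans
      (star_spread_dotProduct_of_ne (by rintro rfl; exact h rfl))
  · left; simp [tileB, low_last]
  · right; simp [tileA, tileFlag]
  · right; simp [tileA, tileFlag, high_zero]
  · left; simp [tileB, low_last]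
  · right
    have hk : k ≠ k' := by rintro rfl; exact h rfl
    exact ⟨(star_low_dotProduct_low _ _).trans (star_domino_dotProduct hk),
      star_dominoFlag_dotProduct hk⟩
  · right; simp [tileA, tileFlag, low_last]
  · left; simp [tileB]
  · right; simp [tileA, tileFlag]
  · right; simp [tileA, tileFlag, low_last]
  · left
    exact (star_high_dotProduct_high _ _).trans
      (star_spread_dotProduct_of_ne (by rintro rfl; exact h rfl))
  · left; simp [tileB, high_zero]
  · right; simp [tileA, tileFlag, high_zero]
  · left; simp [tileB]
  · left; simp [tileB, high_zero]
  · right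
    refine ⟨(star_high_dotProduct_high _ _).trans
      (star_spread_dotProduct_of_ne (by rintro rfl; exact h rfl)), by simp [tileFlag]⟩

/-- A linear functional that vanishes on the orthogonal basis `domino` vanishes. -/
theorem eq_zero_of_dotProduct_domino {p : ℕ} {x : Fin (p + 2) → ℂ}
    (h : ∀ k, x ⬝ᵥ domino k = 0) : x = 0 := by
  have h₀ := h 0
  have h₁ := h 1
  rw [domino_zero_eq, dotProduct_add, dotProduct_single_one, dotProduct_single_one] at h₀
  rw [domino_one_eq, dotProduct_sub, dotProduct_single_one, dotProduct_single_one] at h₁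
  ext k
  refine Fin.cases ?_ (fun k => Fin.cases ?_ (fun k => ?_) k) k
  · show x 0 = 0
    linear_combination (h₀ + h₁) / 2
  · show x 1 = 0
    linear_combination (h₀ - h₁) / 2
  · have h₂ := h k.succ.succ
    rwa [domino_succ_succ_eq, dotProduct_single_one] at h₂

/-- Top row against left column isolates index `0`. On the remaining indices the left column makes
`E` diagonal in `spread`, and bottom row against right column makes the last row of `E` diagonal, so
`E` is scalar there. -/
theorem tileA_rigid (p q : ℕ) : LocallyRigid (tileA : Tile p q → _) tileB := by
  intro E hE
  have h₁ : ∀ i : Fin (p + 2), E 0 i.succ = 0 := by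
    refine fun i => congrFun (eq_zero_of_dotProduct_spread (x := fun i => E 0 i.succ) fun k => ?_) i
    have := hE (.inl (.inl 0)) (.inr (.inr k)) (by simp)
    simp only [tileA, tileB, star_single_dotProduct, star_dotProduct_single, mulVec_high,
      low_zero, mul_eq_zero, star_eq_zero, spread_ne_zero, or_false] at this
    exact this
  have h₂ : ∀ i : Fin (p + 2), E i.succ 0 = 0 := by
    refine fun i =>
      congrFun (eq_zero_of_star_spread_dotProduct (x := fun i => E i.succ 0) fun k => ?_) i
    have := hE (.inr (.inr k)) (.inl (.inl 0)) (by simp)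
    simp only [tileA, tileB, star_single_dotProduct, star_high_dotProduct, Matrix.mulVec_single_one,
      low_zero, mul_eq_zero, spread_ne_zero, or_false] at this
    exact this
  have h₃ : ∀ i : Fin (p + 2), E (Fin.last _) i.castSucc = 0 := by
    refine fun i => congrFun
      (eq_zero_of_dotProduct_domino (x := fun i => E (Fin.last _) i.castSucc) fun k => ?_) i
    have := hE (.inr (.inl 0)) (.inl (.inr k)) (by simp)
    simp only [tileA, tileB, star_single_dotProduct, star_dotProduct_single, mulVec_low,
      high_last, mul_eq_zero, star_eq_zero, spread_ne_zero, or_false] at this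
    exact this
  have h₄ := eq_smul_one_of_spread (E.submatrix Fin.succ Fin.succ) (Fin.last _) (by
    intro j k hjk
    have := hE (.inr (.inr j)) (.inr (.inr k)) (by simpa using hjk)
    simpa [tileA, tileB, star_high_dotProduct_mulVec_high] using this) (by
    intro i hi
    obtain ⟨i, rfl⟩ := Fin.exists_castSucc_eq.2 hi
    exact h₃ i.succ)
  -- The dominoes `e₀ ± e₁` tie index `0` to the rest: their matrix element is `E 0 0 - E 1 1`.
  have h₅ : E 0 0 = E 1 1 := by
    have h := hE (.inl (.inr 0)) (.inl (.inr 1)) (by simp)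
    have h01 : E 0 1 = 0 := h₁ 0
    have h10 : E 1 0 = 0 := h₂ 0
    simp only [tileA, tileB, star_low_dotProduct_mulVec_low, star_single_dotProduct, Pi.single_eq_same,
      mul_one] at h
    rw [domino_zero_eq, domino_one_eq, Matrix.mulVec_sub, star_add, add_dotProduct,
      star_single_dotProduct, star_single_dotProduct, Matrix.mulVec_single_one,
      Matrix.mulVec_single_one] at h
    simp [h01, h10] at h
    linear_combination h
  have h₆ : ∀ i j : Fin (p + 2), E i.succ j.succ = if i = j then E 1 1 else 0 := by
    intro i j
    have h11 := congrFun (congrFun h₄ 0) 0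
    have hij := congrFun (congrFun h₄ i) j
    simp only [Matrix.submatrix_apply, Matrix.smul_apply, Matrix.one_apply, if_true, smul_eq_mul,
      mul_one] at h11 hij
    rw [hij, show E 1 1 = _ from h11]
    simp
  refine ⟨E 1 1, ?_⟩
  ext i j
  rw [Matrix.smul_apply, Matrix.one_apply, smul_eq_mul]
  refine Fin.cases (Fin.cases ?_ (fun j => ?_) j) (fun i => Fin.cases ?_ (fun j => ?_) j) i
  · simp [h₅]
  · simp [h₁, (Fin.succ_ne_zero j).symm]
  · simp [h₂]
  · simp [h₆]

/-- Top and bottom row make `E` diagonal in `spread` on the indices without the last and without the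
first. Neighbouring columns supply the diagonal row that makes each block scalar, and the blocks
share index `1`. -/
theorem tileB_rigid (p q : ℕ) : LocallyRigid (tileB : Tile p q → _) tileA := by
  intro E hE
  have h₁ : ∀ i : Fin (q + 2), E 0 i.succ = 0 := by
    refine fun i => congrFun (eq_zero_of_dotProduct_spread (x := fun i => E 0 i.succ) fun k => ?_) i
    have := hE (.inr (.inr 0)) (.inr (.inl k)) (by simp)
    simp only [tileA, tileB, star_single_dotProduct, star_dotProduct_single, mulVec_high,
      high_last, mul_eq_zero, star_eq_zero, spread_ne_zero, or_false] at this
    exact this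
  have h₂ : ∀ i : Fin (q + 2), E (Fin.last _) i.castSucc = 0 := by
    refine fun i => congrFun
      (eq_zero_of_dotProduct_spread (x := fun i => E (Fin.last _) i.castSucc) fun k => ?_) i
    have := hE (.inl (.inr 0)) (.inl (.inl k)) (by simp)
    simp only [tileA, tileB, star_single_dotProduct, star_dotProduct_single, mulVec_low,
      low_zero, mul_eq_zero, star_eq_zero, domino_self, or_false] at this
    exact this
  have h₃ : ∀ i : Fin (q + 2), E i.castSucc (Fin.last _) = 0 := by
    refine fun i => congrFun
      (eq_zero_of_star_spread_dotProduct (x := fun i => E i.castSucc (Fin.last _)) fun k => ?_) i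
    have := hE (.inl (.inl k)) (.inl (.inr 0)) (by simp)
    simp only [tileA, tileB, star_single_dotProduct, star_low_dotProduct, Matrix.mulVec_single_one,
      low_zero, mul_eq_zero, domino_self, or_false] at this
    exact this
  have h₄ := eq_smul_one_of_spread (E.submatrix Fin.castSucc Fin.castSucc) 0 (by
    intro j k hjk
    have := hE (.inl (.inl j)) (.inl (.inl k)) (by simpa using hjk)
    simpa [tileA, tileB, star_low_dotProduct_mulVec_low] using this) (by
    intro i hi
    obtain ⟨i, rfl⟩ := Fin.exists_succ_eq.2 hi
    exact h₁ i.castSucc)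
  have h₅ := eq_smul_one_of_spread (E.submatrix Fin.succ Fin.succ) (Fin.last _) (by
    intro j k hjk
    have := hE (.inr (.inl j)) (.inr (.inl k)) (by simpa using hjk)
    simpa [tileA, tileB, star_high_dotProduct_mulVec_high] using this) (by
    intro i hi
    obtain ⟨i, rfl⟩ := Fin.exists_castSucc_eq.2 hi
    exact h₂ i.succ)
  have h₆ : E 0 0 = E (Fin.last _) (Fin.last _) := by
    have h := congrFun (congrFun h₄ 1) 1
    have h' := congrFun (congrFun h₅ 0) 0
    simp only [Matrix.submatrix_apply, Matrix.smul_apply, Matrix.one_apply, if_true, smul_eq_mul,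
      mul_one] at h h'
    exact h.symm.trans h'
  refine ⟨E 0 0, ?_⟩
  ext i j
  rw [Matrix.smul_apply, Matrix.one_apply, smul_eq_mul]
  refine Fin.lastCases (Fin.lastCases ?_ (fun j => ?_) j)
    (fun i => Fin.lastCases ?_ (fun j => ?_) j) i
  · simp [h₆]
  · simp [h₂, (Fin.castSucc_ne_last j).symm]
  · simp [h₃, Fin.castSucc_ne_last i]
  · simpa [Matrix.one_apply] using congrFun (congrFun h₄ i) j

/-! ### The direct sum of two index ranges -/

theorem star_append_dotProduct_append {c f : ℕ} (x x' : Fin c → ℂ) (y y' : Fin f → ℂ) :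
    star (Fin.append x y) ⬝ᵥ Fin.append x' y' = star x ⬝ᵥ x' + star y ⬝ᵥ y' := by
  simp [dotProduct, Fin.sum_univ_add]

theorem append_ne_zero_left {c f : ℕ} {x : Fin c → ℂ} (hx : x ≠ 0) (y : Fin f → ℂ) :
    Fin.append x y ≠ 0 := by
  obtain ⟨i, hi⟩ := Function.ne_iff.1 hx
  exact Function.ne_iff.2 ⟨Fin.castAdd f i, by simpa using hi⟩

theorem append_ne_zero_right {c f : ℕ} (x : Fin c → ℂ) {y : Fin f → ℂ} (hy : y ≠ 0) :
    Fin.append x y ≠ 0 := by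
  obtain ⟨i, hi⟩ := Function.ne_iff.1 hy
  exact Function.ne_iff.2 ⟨Fin.natAdd c i, by simpa using hi⟩

theorem lt_of_append_zero_ne_zero {c f : ℕ} {x : Fin c → ℂ} {i : Fin (c + f)}
    (h : Fin.append x (0 : Fin f → ℂ) i ≠ 0) : i.val < c := by
  refine Fin.addCases (fun i _ => ?_) (fun i h => ?_) i h
  · simp
  · simp at h

theorem le_of_zero_append_ne_zero {c f : ℕ} {y : Fin f → ℂ} {i : Fin (c + f)}
    (h : Fin.append (0 : Fin c → ℂ) y i ≠ 0) : c ≤ i.val := by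
  refine Fin.addCases (fun i h => ?_) (fun i _ => ?_) i h
  · simp at h
  · simp

/-- The projection onto the span of the first `c` or the last `f` basis vectors. -/
def blockProj (c f : ℕ) (μ : Fin 2) : Matrix (Fin (c + f)) (Fin (c + f)) ℂ :=
  Matrix.diagonal (Fin.append (fun _ => if μ = 0 then 1 else 0) fun _ => if μ = 0 then 0 else 1)

theorem blockProj_zero_mulVec {c f : ℕ} (x : Fin c → ℂ) (y : Fin f → ℂ) :
    blockProj c f 0 *ᵥ Fin.append x y = Fin.append x 0 := by
  ext i
  refine Fin.addCases (fun i => ?_) (fun i => ?_) i <;> simp [blockProj, Matrix.mulVec_diagonal]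

theorem blockProj_one_mulVec {c f : ℕ} (x : Fin c → ℂ) (y : Fin f → ℂ) :
    blockProj c f 1 *ᵥ Fin.append x y = Fin.append 0 y := by
  ext i
  refine Fin.addCases (fun i => ?_) (fun i => ?_) i <;> simp [blockProj, Matrix.mulVec_diagonal]

theorem isMeasurement_blockProj (c f : ℕ) :
    IsMeasurement (d := fun _ : Fin 2 => c + f) (blockProj c f) := by
  simp only [IsMeasurement, Fin.sum_univ_two, blockProj, Matrix.diagonal_conjTranspose,
    Matrix.diagonal_mul_diagonal, Matrix.diagonal_add, ← Matrix.diagonal_one]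
  congr 1
  ext i
  refine Fin.addCases (fun i => ?_) (fun i => ?_) i <;> simp

/-- The inclusion of the span of the first `c` basis vectors. -/
def leftIncl (c f : ℕ) : Matrix (Fin (c + f)) (Fin c) ℂ :=
  (1 : Matrix (Fin (c + f)) (Fin (c + f)) ℂ).submatrix id (Fin.castAdd f)

/-- The inclusion of the span of the last `f` basis vectors. -/
def rightIncl (c f : ℕ) : Matrix (Fin (c + f)) (Fin f) ℂ :=
  (1 : Matrix (Fin (c + f)) (Fin (c + f)) ℂ).submatrix id (Fin.natAdd c)

theorem leftIncl_isometry (c f : ℕ) : (leftIncl c f)ᴴ * leftIncl c f = 1 := by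
  ext i j
  simp [leftIncl, Matrix.mul_apply, Matrix.one_apply]

theorem rightIncl_isometry (c f : ℕ) : (rightIncl c f)ᴴ * rightIncl c f = 1 := by
  ext i j
  simp [rightIncl, Matrix.mul_apply, Matrix.one_apply]

theorem leftIncl_mulVec {c f : ℕ} (x : Fin c → ℂ) : leftIncl c f *ᵥ x = Fin.append x 0 := by
  ext i
  refine Fin.addCases (fun i => ?_) (fun i => ?_) i
  · simp [leftIncl, Matrix.mulVec, dotProduct, Matrix.one_apply]
  · simp only [leftIncl, Matrix.mulVec, dotProduct, Matrix.one_apply, Matrix.submatrix_apply, id]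
    simp only [Fin.append_right, Pi.zero_apply]
    refine Finset.sum_eq_zero fun j _ => ?_
    rw [if_neg (by simp only [Fin.ext_iff, Fin.val_castAdd, Fin.val_natAdd]; omega), zero_mul]

theorem rightIncl_mulVec {c f : ℕ} (y : Fin f → ℂ) : rightIncl c f *ᵥ y = Fin.append 0 y := by
  ext i
  refine Fin.addCases (fun i => ?_) (fun i => ?_) i
  · simp only [rightIncl, Matrix.mulVec, dotProduct, Matrix.one_apply, Matrix.submatrix_apply, id]
    simp only [Fin.append_left, Pi.zero_apply]
    refine Finset.sum_eq_zero fun j _ => ?_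
    rw [if_neg (by simp only [Fin.ext_iff, Fin.val_castAdd, Fin.val_natAdd]; omega), zero_mul]
  · simp [rightIncl, Matrix.mulVec, dotProduct, Matrix.one_apply]

theorem injective_of_orthogonal {Λ α : Type*} [Fintype α] {v : Λ → α → ℂ} (h₀ : ∀ ℓ, v ℓ ≠ 0)
    (h : ∀ ℓ ℓ', ℓ ≠ ℓ' → star (v ℓ) ⬝ᵥ v ℓ' = 0) : Function.Injective v := by
  intro ℓ ℓ' he
  by_contra hne
  have := h ℓ ℓ' hne
  rw [← he] at this
  exact h₀ ℓ (eq_zero_of_star_dotProduct_self this)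

theorem encard_range_of_injective {α β : Type*} {g : α → β} (hg : Function.Injective g) :
    (Set.range g).encard = ENat.card α := by
  rw [← Set.image_univ, hg.encard_image, Set.encard_univ]

/-! ### One block of the construction -/

theorem card_tile (p q : ℕ) : ENat.card (Tile p q) = ((2 * ((p + 3) + (q + 3)) - 4 : ℕ) : ℕ∞) := by
  rw [ENat.card_eq_coe_fintype_card]
  congr 1
  simp only [Tile, Fintype.card_sum, Fintype.card_fin]
  omega

theorem tileState_ne_zero {p q : ℕ} (ℓ : Tile p q) : prodState (tileA ℓ) (tileB ℓ) ≠ 0 :=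
  prodState_ne_zero (tileA_ne_zero ℓ) (tileB_ne_zero ℓ)

theorem not_locallyDistinguishable_range_tile {p q m n : ℕ} {A : Matrix (Fin m) (Fin (p + 3)) ℂ}
    {B : Matrix (Fin n) (Fin (q + 3)) ℂ} (hA : Aᴴ * A = 1) (hB : Bᴴ * B = 1)
    (hinj : Function.Injective fun ℓ : Tile p q => prodState (A *ᵥ tileA ℓ) (B *ᵥ tileB ℓ)) :
    ¬ LocallyDistinguishable
      (Set.range fun ℓ : Tile p q => prodState (A *ᵥ tileA ℓ) (B *ᵥ tileB ℓ)) :=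
  not_locallyDistinguishable_of_locallyRigid (tileA_rigid p q) (tileB_rigid p q)
    (Nat.succ_pos _) (Nat.succ_pos _) (i := .inl (.inl 0)) (j := .inl (.inr 0)) (by simp)
    (tileState_ne_zero _) (tileState_ne_zero _) A B hA hB hinj fun ℓ => ⟨ℓ, rfl⟩

/-- With the flags, the vectors of the boundary tiling are locally distinguishable. -/
theorem locallyDistinguishable_flagged_tile {p q f m n : ℕ} {a : Tile p q → Fin m → ℂ}
    {b : Tile p q → Fin n → ℂ}
    (ha : ∀ ℓ ℓ', star (a ℓ) ⬝ᵥ a ℓ' = star (tileA ℓ) ⬝ᵥ tileA ℓ' +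
      star (tileFlag ℓ : Fin (f + 3) → ℂ) ⬝ᵥ tileFlag ℓ')
    (hb : ∀ ℓ ℓ', star (b ℓ) ⬝ᵥ b ℓ' = star (tileB ℓ) ⬝ᵥ tileB ℓ') :
    LocallyDistinguishable (Set.range fun ℓ => prodState (a ℓ) (b ℓ)) := by
  -- The order of elimination: Alice splits off the top row, Bob the left column, Alice the right
  -- column; the bottom row remains.
  have hcover : (Set.univ : Set (Tile p q)) =
      Set.range (fun j => .inl (.inl j)) ∪ (Set.range (fun k => .inr (.inr k)) ∪
        (Set.range (fun k => .inl (.inr k)) ∪ Set.range fun j => .inr (.inl j))) := by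
    refine (Set.eq_univ_of_forall ?_).symm
    rintro ((j | k) | (j | k)) <;> simp
  rw [← Set.image_univ, hcover]
  refine locallyDistinguishable_union_alice ?_ (locallyDistinguishable_of_orthogonal_bob ?_)
    (locallyDistinguishable_union_bob ?_ (locallyDistinguishable_of_orthogonal_alice ?_)
      (locallyDistinguishable_union_alice ?_ (locallyDistinguishable_of_orthogonal_alice ?_)
        (locallyDistinguishable_of_orthogonal_bob ?_)))
  · rintro _ ⟨j, rfl⟩ _ (⟨k, rfl⟩ | ⟨k, rfl⟩ | ⟨j', rfl⟩) <;>
      simp only [ha, tileA, tileFlag, star_single_dotProduct]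
    · simp [high_zero]
    · rw [low_zero, domino_zero_add_dominoFlag_zero]
    · simp [Fin.ext_iff]
  · rintro _ ⟨j, rfl⟩ _ ⟨j', rfl⟩ hne
    simp only [hb, tileB, star_low_dotProduct_low]
    exact star_spread_dotProduct_of_ne (by rintro rfl; exact hne rfl)
  · rintro _ ⟨j, rfl⟩ _ (⟨k, rfl⟩ | ⟨j', rfl⟩) <;>
      simp [hb, tileB, high_zero, Fin.ext_iff]
  · rintro _ ⟨j, rfl⟩ _ ⟨j', rfl⟩ hne
    simp only [ha, tileA, tileFlag, star_high_dotProduct_high, dotProduct_zero, add_zero]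
    exact star_spread_dotProduct_of_ne (by rintro rfl; exact hne rfl)
  · rintro _ ⟨j, rfl⟩ _ ⟨j', rfl⟩
    simp [ha, tileA, tileFlag, low_last]
  · rintro _ ⟨j, rfl⟩ _ ⟨j', rfl⟩ hne
    have hj : j ≠ j' := by rintro rfl; exact hne rfl
    simp only [ha, tileA, tileFlag, star_low_dotProduct_low]
    rw [star_domino_dotProduct hj, star_dominoFlag_dotProduct hj, add_zero]
  · rintro _ ⟨j, rfl⟩ _ ⟨j', rfl⟩ hne
    simp only [hb, tileB, star_high_dotProduct_high]
    exact star_spread_dotProduct_of_ne (by rintro rfl; exact hne rfl)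

/-! ### The set of states -/

section Activation

variable (p f q k : ℕ)

/-- Alice's part of the two flagged tilings. -/
noncomputable def flaggedA : Tile p q ⊕ Tile f k → Fin (p + 3 + (f + 3)) → ℂ
  | .inl ℓ => Fin.append (tileA ℓ) (tileFlag ℓ)
  | .inr ℓ => Fin.append (tileFlag ℓ) (tileA ℓ)

/-- Bob's part of the two flagged tilings. -/
noncomputable def flaggedB : Tile p q ⊕ Tile f k → Fin (q + 3 + (k + 3)) → ℂ
  | .inl ℓ => Fin.append (tileB ℓ) 0
  | .inr ℓ => Fin.append 0 (tileB ℓ)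

/-- The states of the two flagged tilings. -/
noncomputable def flaggedState (ℓ : Tile p q ⊕ Tile f k) :
    BiState (p + 3 + (f + 3)) (q + 3 + (k + 3)) :=
  prodState (flaggedA p f q k ℓ) (flaggedB p f q k ℓ)

/-- Alice's measurement, which tells the two blocks of dimensions apart. -/
noncomputable def blockMeasurement (μ : Fin 2) :
    Matrix (Fin (p + 3 + (f + 3)) × Fin (q + 3 + (k + 3)))
      (Fin (p + 3 + (f + 3)) × Fin (q + 3 + (k + 3))) ℂ :=
  blockProj (p + 3) (f + 3) μ ⊗ₖ 1

theorem flaggedA_ne_zero (ℓ : Tile p q ⊕ Tile f k) : flaggedA p f q k ℓ ≠ 0 := by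
  rcases ℓ with ℓ | ℓ
  · exact append_ne_zero_left (tileA_ne_zero ℓ) _
  · exact append_ne_zero_right _ (tileA_ne_zero ℓ)

theorem flaggedB_ne_zero (ℓ : Tile p q ⊕ Tile f k) : flaggedB p f q k ℓ ≠ 0 := by
  rcases ℓ with ℓ | ℓ
  · exact append_ne_zero_left (tileB_ne_zero ℓ) _
  · exact append_ne_zero_right _ (tileB_ne_zero ℓ)

theorem flaggedState_ne_zero (ℓ : Tile p q ⊕ Tile f k) : flaggedState p f q k ℓ ≠ 0 :=
  prodState_ne_zero (flaggedA_ne_zero p f q k ℓ) (flaggedB_ne_zero p f q k ℓ)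

theorem blockMeasurement_mulVec (μ : Fin 2) (ℓ : Tile p q ⊕ Tile f k) :
    blockMeasurement p f q k μ *ᵥ flaggedState p f q k ℓ =
      prodState (blockProj (p + 3) (f + 3) μ *ᵥ flaggedA p f q k ℓ) (flaggedB p f q k ℓ) := by
  rw [blockMeasurement, flaggedState, kronecker_mulVec_prodState, Matrix.one_mulVec]

/-- Bob's vectors separate the blocks. Within a block, tile and flag contributions to Alice's inner
product vanish separately, so each projection keeps it zero. -/
theorem flagged_orthogonal {ℓ ℓ' : Tile p q ⊕ Tile f k} (h : ℓ ≠ ℓ') :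
    star (flaggedB p f q k ℓ) ⬝ᵥ flaggedB p f q k ℓ' = 0 ∨
      (star (flaggedA p f q k ℓ) ⬝ᵥ flaggedA p f q k ℓ' = 0 ∧
      ∀ μ, star (blockProj (p + 3) (f + 3) μ *ᵥ flaggedA p f q k ℓ) ⬝ᵥ
        (blockProj (p + 3) (f + 3) μ *ᵥ flaggedA p f q k ℓ') = 0) := by
  rcases ℓ with ℓ | ℓ <;> rcases ℓ' with ℓ' | ℓ'
  · refine (tile_orthogonal (f := f) (show ℓ ≠ ℓ' by rintro rfl; exact h rfl)).imp
      (fun h => ?_) fun h => ⟨?_, fun μ => ?_⟩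
    · simp [flaggedB, star_append_dotProduct_append, h]
    · simp [flaggedA, star_append_dotProduct_append, h]
    · fin_cases μ <;> simp [flaggedA, star_append_dotProduct_append, h, blockProj_zero_mulVec,
        blockProj_one_mulVec]
  · left; simp [flaggedB, star_append_dotProduct_append]
  · left; simp [flaggedB, star_append_dotProduct_append]
  · refine (tile_orthogonal (f := p) (show ℓ ≠ ℓ' by rintro rfl; exact h rfl)).imp
      (fun h => ?_) fun h => ⟨?_, fun μ => ?_⟩
    · simp [flaggedB, star_append_dotProduct_append, h]
    · simp [flaggedA, star_append_dotProduct_append, h]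
    · fin_cases μ <;> simp [flaggedA, star_append_dotProduct_append, h, blockProj_zero_mulVec,
        blockProj_one_mulVec]

theorem flaggedState_orthogonal {ℓ ℓ' : Tile p q ⊕ Tile f k} (h : ℓ ≠ ℓ') :
    star (flaggedState p f q k ℓ) ⬝ᵥ flaggedState p f q k ℓ' = 0 := by
  rw [flaggedState, flaggedState, star_prodState_dotProduct]
  rcases flagged_orthogonal p f q k h with h | h
  · rw [h, mul_zero]
  · rw [h.1, zero_mul]

theorem blockMeasurement_orthogonal (μ : Fin 2) {ℓ ℓ' : Tile p q ⊕ Tile f k} (h : ℓ ≠ ℓ') :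
    star (blockMeasurement p f q k μ *ᵥ flaggedState p f q k ℓ) ⬝ᵥ
      (blockMeasurement p f q k μ *ᵥ flaggedState p f q k ℓ') = 0 := by
  rw [blockMeasurement_mulVec, blockMeasurement_mulVec, star_prodState_dotProduct]
  rcases flagged_orthogonal p f q k h with h | h
  · rw [h, mul_zero]
  · rw [h.2, zero_mul]

theorem flaggedState_injective : Function.Injective (flaggedState p f q k) :=
  injective_of_orthogonal (flaggedState_ne_zero p f q k) fun _ _ h =>
    flaggedState_orthogonal p f q k h

theorem isOrthogonalStateSet_flagged :
    IsOrthogonalStateSet (Set.range (flaggedState p f q k)) := by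
  constructor
  · rintro _ ⟨ℓ, rfl⟩
    exact flaggedState_ne_zero p f q k ℓ
  · rintro _ ⟨ℓ, rfl⟩ _ ⟨ℓ', rfl⟩ hne
    exact flaggedState_orthogonal p f q k (by rintro rfl; exact hne rfl)

theorem locallyDistinguishable_flagged :
    LocallyDistinguishable (Set.range (flaggedState p f q k)) := by
  have h : Set.range (flaggedState p f q k) =
      (fun ℓ => prodState (flaggedA p f q k ℓ) (flaggedB p f q k ℓ)) ''
        (Set.range Sum.inl ∪ Set.range Sum.inr) := by
    rw [Set.range_inl_union_range_inr, Set.image_univ]; rfl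
  rw [h]
  refine locallyDistinguishable_union_bob ?_ ?_ ?_
  · rintro _ ⟨ℓ, rfl⟩ _ ⟨ℓ', rfl⟩
    simp [flaggedB, star_append_dotProduct_append]
  · rw [← Set.range_comp]
    refine locallyDistinguishable_flagged_tile (f := f) (a := fun ℓ => flaggedA p f q k (.inl ℓ))
      (b := fun ℓ => flaggedB p f q k (.inl ℓ)) (fun ℓ ℓ' => ?_) fun ℓ ℓ' => ?_
    · simp [flaggedA, star_append_dotProduct_append]
    · simp [flaggedB, star_append_dotProduct_append]
  · rw [← Set.range_comp]
    refine locallyDistinguishable_flagged_tile (f := p) (a := fun ℓ => flaggedA p f q k (.inr ℓ))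
      (b := fun ℓ => flaggedB p f q k (.inr ℓ)) (fun ℓ ℓ' => ?_) fun ℓ ℓ' => ?_
    · simp [flaggedA, star_append_dotProduct_append, add_comm]
    · simp [flaggedB, star_append_dotProduct_append]

theorem not_locallyRedundant_flagged (hf : f < p) (hk : k < q) :
    ¬ LocallyRedundant (Set.range (flaggedState p f q k)) := by
  refine not_locallyRedundant (a := flaggedA p f q k) (b := flaggedB p f q k)
    (flaggedState_injective p f q k) (flaggedA_ne_zero p f q k) (flaggedB_ne_zero p f q k)
    -- The right column of the large block and one vector of its bottom row: `p + 3 > m / 2` vectors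
    -- that overlap in Bob's last index of this block.
    (fun i : Option (Fin (p + 2)) =>
      i.elim (.inl (.inr (.inl 0))) fun j => .inl (.inl (.inr j))) ?_ ?_ ?_
    -- All top rows share Alice's vector `e₀ ⊕ e₀`; one from the small block completes the `q + 2`
    -- of the large one to `q + 3 > n / 2`.
    (fun i : Option (Fin (q + 2)) =>
      i.elim (.inr (.inl (.inl 0))) fun j => .inl (.inl (.inl j))) ?_ ?_ ?_
  · rintro (_ | i) (_ | j) h <;> simp_all
  · simp; omega
  · rintro (_ | i) (_ | j) h
    · exact absurd rfl h
    · simp [flaggedB, tileB, star_append_dotProduct_append, high_last, spread_ne_zero]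
    · simp [flaggedB, tileB, star_append_dotProduct_append, high_last, spread_ne_zero]
    · simp [flaggedB, tileB, star_append_dotProduct_append]
  · rintro (_ | i) (_ | j) h <;> simp_all
  · simp; omega
  · rintro (_ | i) (_ | j) h
    · exact absurd rfl h
    all_goals
      simp [flaggedA, tileA, tileFlag, star_append_dotProduct_append]

/-! ### The states after Alice's measurement -/

theorem postMeasurementSet_inl :
    postMeasurementSet (blockMeasurement p f q k 0)
        (Set.range fun ℓ => flaggedState p f q k (.inl ℓ)) =
      Set.range fun ℓ : Tile p q =>
        prodState (leftIncl (p + 3) (f + 3) *ᵥ tileA ℓ) (leftIncl (q + 3) (k + 3) *ᵥ tileB ℓ) := by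
  have h : ∀ ℓ : Tile p q, blockMeasurement p f q k 0 *ᵥ flaggedState p f q k (.inl ℓ) =
      prodState (leftIncl (p + 3) (f + 3) *ᵥ tileA ℓ) (leftIncl (q + 3) (k + 3) *ᵥ tileB ℓ) := by
    intro ℓ
    rw [blockMeasurement_mulVec, leftIncl_mulVec, leftIncl_mulVec, flaggedA, flaggedB,
      blockProj_zero_mulVec]
  rw [postMeasurementSet, ← Set.range_comp]
  simp only [Function.comp_def, h]
  refine sdiff_eq_left.2 (Set.disjoint_singleton_right.2 ?_)
  rintro ⟨ℓ, hℓ⟩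
  simp only [leftIncl_mulVec] at hℓ
  exact prodState_ne_zero (append_ne_zero_left (tileA_ne_zero ℓ) _)
    (append_ne_zero_left (tileB_ne_zero ℓ) _) hℓ

theorem postMeasurementSet_inr :
    postMeasurementSet (blockMeasurement p f q k 1)
        (Set.range fun ℓ => flaggedState p f q k (.inr ℓ)) =
      Set.range fun ℓ : Tile f k =>
        prodState (rightIncl (p + 3) (f + 3) *ᵥ tileA ℓ) (rightIncl (q + 3) (k + 3) *ᵥ tileB ℓ) := by
  have h : ∀ ℓ : Tile f k, blockMeasurement p f q k 1 *ᵥ flaggedState p f q k (.inr ℓ) =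
      prodState (rightIncl (p + 3) (f + 3) *ᵥ tileA ℓ) (rightIncl (q + 3) (k + 3) *ᵥ tileB ℓ) := by
    intro ℓ
    rw [blockMeasurement_mulVec, rightIncl_mulVec, rightIncl_mulVec, flaggedA, flaggedB,
      blockProj_one_mulVec]
  rw [postMeasurementSet, ← Set.range_comp]
  simp only [Function.comp_def, h]
  refine sdiff_eq_left.2 (Set.disjoint_singleton_right.2 ?_)
  rintro ⟨ℓ, hℓ⟩
  simp only [rightIncl_mulVec] at hℓ
  exact prodState_ne_zero (append_ne_zero_right _ (tileA_ne_zero ℓ))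
    (append_ne_zero_right _ (tileB_ne_zero ℓ)) hℓ

theorem leftInclTile_injective :
    Function.Injective fun ℓ : Tile p q =>
      prodState (leftIncl (p + 3) (f + 3) *ᵥ tileA ℓ) (leftIncl (q + 3) (k + 3) *ᵥ tileB ℓ) := by
  refine injective_of_orthogonal (fun ℓ => ?_) fun ℓ ℓ' h => ?_
  · rw [leftIncl_mulVec, leftIncl_mulVec]
    exact prodState_ne_zero (append_ne_zero_left (tileA_ne_zero ℓ) _)
      (append_ne_zero_left (tileB_ne_zero ℓ) _)
  · rw [star_prodState_dotProduct, star_mulVec_dotProduct_mulVec, star_mulVec_dotProduct_mulVec,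
      leftIncl_isometry, leftIncl_isometry, Matrix.one_mulVec, Matrix.one_mulVec]
    rcases tile_orthogonal (f := 0) h with h | h <;> simp [h]

theorem rightInclTile_injective :
    Function.Injective fun ℓ : Tile f k =>
      prodState (rightIncl (p + 3) (f + 3) *ᵥ tileA ℓ) (rightIncl (q + 3) (k + 3) *ᵥ tileB ℓ) := by
  refine injective_of_orthogonal (fun ℓ => ?_) fun ℓ ℓ' h => ?_
  · rw [rightIncl_mulVec, rightIncl_mulVec]
    exact prodState_ne_zero (append_ne_zero_right _ (tileA_ne_zero ℓ))
      (append_ne_zero_right _ (tileB_ne_zero ℓ))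
  · rw [star_prodState_dotProduct, star_mulVec_dotProduct_mulVec, star_mulVec_dotProduct_mulVec,
      rightIncl_isometry, rightIncl_isometry, Matrix.one_mulVec, Matrix.one_mulVec]
    rcases tile_orthogonal (f := 0) h with h | h <;> simp [h]

theorem postMeasurementSet_mono {m n : ℕ} (L : Matrix (Fin m × Fin n) (Fin m × Fin n) ℂ)
    {S T : Set (BiState m n)} (h : S ⊆ T) : postMeasurementSet L S ⊆ postMeasurementSet L T :=
  Set.sdiff_subset_sdiff_left (Set.image_mono h)

theorem not_locallyDistinguishable_inl : ¬ LocallyDistinguishable (postMeasurementSet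
    (blockMeasurement p f q k 0) (Set.range fun ℓ => flaggedState p f q k (.inl ℓ))) := by
  rw [postMeasurementSet_inl]
  exact not_locallyDistinguishable_range_tile (leftIncl_isometry _ _) (leftIncl_isometry _ _)
    (leftInclTile_injective p f q k)

theorem not_locallyDistinguishable_inr : ¬ LocallyDistinguishable (postMeasurementSet
    (blockMeasurement p f q k 1) (Set.range fun ℓ => flaggedState p f q k (.inr ℓ))) := by
  rw [postMeasurementSet_inr]
  exact not_locallyDistinguishable_range_tile (rightIncl_isometry _ _) (rightIncl_isometry _ _)
    (rightInclTile_injective p f q k)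

theorem encard_postMeasurementSet_lt {m n : ℕ} {L : Matrix (Fin m × Fin n) (Fin m × Fin n) ℂ}
    {S : Set (BiState m n)} (hS : S.Finite) {ψ : BiState m n} (hψ : ψ ∈ S) (h : L *ᵥ ψ = 0) :
    (postMeasurementSet L S).encard < S.encard := by
  have hsub : postMeasurementSet L S ⊆ (fun φ => L *ᵥ φ) '' (S \ {ψ}) := by
    rintro _ ⟨⟨φ, hφ, rfl⟩, h0⟩
    exact ⟨φ, ⟨hφ, by rintro rfl; exact h0 h⟩, rfl⟩
  refine ((Set.encard_le_encard hsub).trans (Set.encard_image_le _ _)).trans_lt ?_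
  exact hS.sdiff.encard_lt_encard ⟨Set.sdiff_subset, fun hc => (hc hψ).2 rfl⟩

theorem activatesTypeII_flagged :
    ActivatesTypeII (blockMeasurement p f q k) (Set.range (flaggedState p f q k)) := by
  refine ⟨⟨.inl ⟨_, isMeasurement_blockProj _ _, fun _ => rfl⟩, fun μ => ?_⟩, fun μ => ?_, 1, ?_⟩
  · rintro _ ⟨ℓ, rfl⟩ _ ⟨ℓ', rfl⟩ hne
    exact blockMeasurement_orthogonal p f q k μ (by rintro rfl; exact hne rfl)
  · fin_cases μ
    -- The surviving flags of the other block only enlarge the set, so it stays indistinguishable.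
    · exact fun h => not_locallyDistinguishable_inl p f q k (h.mono (postMeasurementSet_mono _
        (Set.range_comp_subset_range Sum.inl (flaggedState p f q k))))
    · exact fun h => not_locallyDistinguishable_inr p f q k (h.mono (postMeasurementSet_mono _
        (Set.range_comp_subset_range Sum.inr (flaggedState p f q k))))
  -- The bottom row of the large block has flag `0`, so outcome `1` annihilates it.
  · refine encard_postMeasurementSet_lt (Set.finite_range _)
      ⟨.inl (.inr (.inl 0)), rfl⟩ ?_
    rw [blockMeasurement_mulVec, flaggedA, blockProj_one_mulVec]
    have : Fin.append (0 : Fin (p + 3) → ℂ)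
        (tileFlag (.inr (.inl 0) : Tile p q) : Fin (f + 3) → ℂ) = 0 := by
      ext i
      refine Fin.addCases (fun i => ?_) (fun i => ?_) i <;> simp [tileFlag]
    rw [this, prodState_zero_left]

theorem encard_flagged : (Set.range (flaggedState p f q k)).encard =
    ((2 * ((p + 3 + (f + 3)) + (q + 3 + (k + 3))) - 8 : ℕ) : ℕ∞) := by
  rw [encard_range_of_injective (flaggedState_injective p f q k), ENat.card_eq_coe_fintype_card]
  congr 1
  simp only [Tile, Fintype.card_sum, Fintype.card_fin]
  omega

end Activation

/-- The bound `7` is what gives the small block the three dimensions a pinwheel needs; `f < p` holds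
because the large block exceeds half of `m`. -/
theorem exists_eq_add_of_seven_le {m : ℕ} (hm : 7 ≤ m) :
    ∃ p f, f < p ∧ m = p + 3 + (f + 3) ∧ largeDim m = p + 3 ∧ smallDim m = f + 3 := by
  refine ⟨m - (m - 1) / 2 - 3, (m - 1) / 2 - 3, ?_⟩
  unfold largeDim smallDim
  omega

theorem theorem4 (m n : ℕ) (hm : 7 ≤ m) (hn : 7 ≤ n) :
    ∃ S : Set (BiState m n),
      IsOrthogonalStateSet S ∧ (∀ ψ ∈ S, IsProductState ψ) ∧
      HasGenuineHiddenNonlocalityII S ∧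
      S.encard = ((2 * (m + n) - 8 : ℕ) : ℕ∞) ∧
      ∃ (M : Fin 2 → Matrix (Fin m × Fin n) (Fin m × Fin n) ℂ) (S₁ S₂ : Set (BiState m n)),
        ActivatesTypeII M S ∧ S = S₁ ∪ S₂ ∧ Disjoint S₁ S₂ ∧
        (¬ LocallyDistinguishable (postMeasurementSet (M 0) S₁) ∧
          (postMeasurementSet (M 0) S₁).encard =
            ((2 * (largeDim m + largeDim n) - 4 : ℕ) : ℕ∞) ∧
          ∀ ψ ∈ postMeasurementSet (M 0) S₁, ∀ i j, ψ (i, j) ≠ 0 →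
            i.val < largeDim m ∧ j.val < largeDim n) ∧
        (¬ LocallyDistinguishable (postMeasurementSet (M 1) S₂) ∧
          (postMeasurementSet (M 1) S₂).encard =
            ((2 * (smallDim m + smallDim n) - 4 : ℕ) : ℕ∞) ∧
          ∀ ψ ∈ postMeasurementSet (M 1) S₂, ∀ i j, ψ (i, j) ≠ 0 →
            largeDim m ≤ i.val ∧ largeDim n ≤ j.val) := by
  obtain ⟨p, f, hf, rfl, hlm, hsm⟩ := exists_eq_add_of_seven_le hm
  obtain ⟨q, k, hk, rfl, hln, hsn⟩ := exists_eq_add_of_seven_le hn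
  rw [hlm, hsm, hln, hsn]
  refine ⟨Set.range (flaggedState p f q k), isOrthogonalStateSet_flagged p f q k, ?_,
    ⟨locallyDistinguishable_flagged p f q k, not_locallyRedundant_flagged p f q k hf hk, 2, _,
      activatesTypeII_flagged p f q k⟩, encard_flagged p f q k, blockMeasurement p f q k,
    Set.range fun ℓ => flaggedState p f q k (.inl ℓ),
    Set.range fun ℓ => flaggedState p f q k (.inr ℓ), activatesTypeII_flagged p f q k, ?_, ?_,
    ⟨not_locallyDistinguishable_inl p f q k, ?_, ?_⟩,
    ⟨not_locallyDistinguishable_inr p f q k, ?_, ?_⟩⟩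
  · rintro _ ⟨ℓ, rfl⟩
    exact prodState_isProductState _ _
  · ext ψ
    simp [Sum.exists]
  · rw [Set.disjoint_left]
    rintro _ ⟨ℓ, rfl⟩ ⟨ℓ', h⟩
    exact Sum.inr_ne_inl (flaggedState_injective p f q k h)
  · rw [postMeasurementSet_inl, encard_range_of_injective (leftInclTile_injective p f q k),
      card_tile]
  · rw [postMeasurementSet_inl]
    rintro _ ⟨ℓ, rfl⟩ i j h
    simp only [leftIncl_mulVec] at h
    exact ⟨lt_of_append_zero_ne_zero (left_ne_zero_of_mul h),
      lt_of_append_zero_ne_zero (right_ne_zero_of_mul h)⟩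
  · rw [postMeasurementSet_inr, encard_range_of_injective (rightInclTile_injective p f q k),
      card_tile]
  · rw [postMeasurementSet_inr]
    rintro _ ⟨ℓ, rfl⟩ i j h
    simp only [rightIncl_mulVec] at h
    exact ⟨le_of_zero_append_ne_zero (left_ne_zero_of_mul h),
      le_of_zero_append_ne_zero (right_ne_zero_of_mul h)⟩
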